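/- Work in an operational probabilistic theory: systems and events form a symmetric monoidal category (composite systems $A\otimes B$, trivial system $\mathbf 1$, sequential and parallel composition); a test from $A$ to $B$ is a finite family of events $A\to B$ indexed by its outcomes; every event belongs to some test; tests are closed under renaming of outcomes and under sequential and parallel composition, and the identities and the structural isomorphisms (including swaps) are tests with a single outcome; every test can be coarse-grained by merging outcomes, probabilities being added in every circuit; each event $\mathbf 1\to\mathbf 1$ has a probability in $[0,\infty)$, these sum to one over every test $\mathbf 1\to\mathbf 1$ and multiply under composition. Assume that the theory is non-signalling, i.e. every system $A$ has exactly one event $A\to\mathbf 1$ that forms a test with a single outcome (the discarding test). For a finite index set $N$ and $m\ge 0$, a probability distribution $p$ on $\prod_{j\in N}\mathcal V_j$ ($\mathcal V_j$ finite) is said to arise from a generalized Bayesian network (GBN) of shape $\mathcal G_{|N|,m}$, or to be compatible with $\mathcal G_{|N|,m}$, if there are, in the theory: for each $I\subseteq N$ with $|I|=m$ and each $j\in I$ a system $A_{I,j}$; for each such $I$ a preparation test $\sigma_I$ with a single outcome and output $\bigotimes_{j\in I}A_{I,j}$; and for each $j\in N$ a measurement test $(M_j^{v})_{v\in\mathcal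 V_j}$ with input $\bigotimes_{I\ni j}A_{I,j}$; such that for all $v$ the number $p(v)$ is the probability of the closed event obtained by connecting all the preparations $\sigma_I$ with all the events $M_j^{v_j}$ along the wires $A_{I,j}$. Lemma. Let $1\le m\le n$, let $p$ be a distribution of $V_1,\dots,V_n$ that arises from a GBN of shape $\mathcal G_{n,m}$ in such a theory, and let $i\in\{1,\dots,n\}$. Then there is a probability distribution $p'$ of $V_1,\dots,V_n$ (with the same values) such that $p'(v_i,v_j)=p(v_i,v_j)$ for every $j\ne i$, and the marginal $p'(v_1,\dots,v_{i-1},v_{i+1},\dots,v_n)$ is compatible with $\mathcal G_{n-1,m-1}$, in the same theory. -/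

import Mathlib

open CategoryTheory MonoidalCategory

universe v u

/-- An operational probabilistic theory.  The objects of the symmetric monoidal category `C` are
the systems (`A ⊗ B` is the composite system, `𝟙_ C` the trivial one), the morphisms are the events,
composed sequentially by `≫` and in parallel by `⊗ₘ`.  A test from `A` to `B` is a finite family of
events indexed by the possible outcomes.  Closed tests (from the trivial system to itself) are
probability distributions, and independent closed events have product probabilities.  Events with
the same probabilities in all circuits are allowed, but not required, to be equal. -/
structure OperationalTheory (C : Type u) [Category.{v} C] [MonoidalCategory C]
    [SymmetricCategory C] where
  /-- The family `f`, indexed by outcomes, is a test from `A` to `B`. -/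
  IsTest : ∀ {X : Type} {A B : C}, (X → (A ⟶ B)) → Prop
  /-- The probability of a closed event. -/
  prob : (𝟙_ C ⟶ 𝟙_ C) → ℝ
  /-- Tests have finitely many outcomes. -/
  finite_of_isTest : ∀ {X : Type} {A B : C} {f : X → (A ⟶ B)}, IsTest f → Finite X
  /-- Every event is an event of some test. -/
  exists_isTest : ∀ {A B : C} (f : A ⟶ B), ∃ (X : Type) (g : X → (A ⟶ B)) (x : X),
    IsTest g ∧ g x = f
  /-- Outcomes of tests may be renamed. -/
  isTest_relabel : ∀ {X Y : Type} {A B : C} {f : X → (A ⟶ B)} (e : Y ≃ X),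
    IsTest f → IsTest (fun y => f (e y))
  /-- Doing nothing, regrouping systems, inserting or removing the trivial system and swapping
  systems are tests with one outcome. -/
  isTest_id : ∀ A : C, IsTest (fun _ : Unit => 𝟙 A)
  isTest_associator_hom : ∀ A B D : C, IsTest (fun _ : Unit => (α_ A B D).hom)
  isTest_associator_inv : ∀ A B D : C, IsTest (fun _ : Unit => (α_ A B D).inv)
  isTest_leftUnitor_hom : ∀ A : C, IsTest (fun _ : Unit => (λ_ A).hom)
  isTest_leftUnitor_inv : ∀ A : C, IsTest (fun _ : Unit => (λ_ A).inv)
  isTest_rightUnitor_hom : ∀ A : C, IsTest (fun _ : Unit => (ρ_ A).hom)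
  isTest_rightUnitor_inv : ∀ A : C, IsTest (fun _ : Unit => (ρ_ A).inv)
  isTest_braiding : ∀ A B : C, IsTest (fun _ : Unit => (β_ A B).hom)
  /-- Sequential composition of tests. -/
  isTest_comp : ∀ {X Y : Type} {A B D : C} {f : X → (A ⟶ B)} {g : Y → (B ⟶ D)},
    IsTest f → IsTest g → IsTest (fun z : X × Y => f z.1 ≫ g z.2)
  /-- Parallel composition of tests. -/
  isTest_tensor : ∀ {X Y : Type} {A B A' B' : C} {f : X → (A ⟶ B)} {g : Y → (A' ⟶ B')},
    IsTest f → IsTest g → IsTest (fun z : X × Y => f z.1 ⊗ₘ g z.2)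
  /-- Coarse-graining: merging the outcomes of a test `f` in the blocks of a partition (the fibres
  of `π`) gives a test, each of whose events has, in every circuit, the sum of the probabilities of
  the merged events. -/
  coarseGrain : ∀ {X Y : Type} [Fintype X] [DecidableEq Y] {A B : C} {f : X → (A ⟶ B)},
    IsTest f → ∀ π : X → Y, Function.Surjective π → ∃ g : Y → (A ⟶ B), IsTest g ∧
      ∀ (y : Y) (E : C) (ρ : 𝟙_ C ⟶ A ⊗ E) (ε : B ⊗ E ⟶ 𝟙_ C),
        prob (ρ ≫ (g y ▷ E) ≫ ε) =
          ∑ x ∈ Finset.univ.filter (fun x => π x = y), prob (ρ ≫ (f x ▷ E) ≫ ε)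
  prob_nonneg : ∀ s, 0 ≤ prob s
  sum_prob : ∀ {X : Type} [Fintype X] {f : X → (𝟙_ C ⟶ 𝟙_ C)}, IsTest f → ∑ x, prob (f x) = 1
  prob_comp : ∀ s t : 𝟙_ C ⟶ 𝟙_ C, prob (s ≫ t) = prob s * prob t

/-- Every system can be discarded in exactly one way: it has a unique measurement with a single
outcome (equivalently, the theory is non-signalling). -/
def OperationalTheory.IsCausal {C : Type u} [Category.{v} C] [MonoidalCategory C]
    [SymmetricCategory C] (T : OperationalTheory C) : Prop :=
  ∀ A : C, ∃! e : A ⟶ 𝟙_ C, T.IsTest (fun _ : Unit => e)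

namespace Circuit

variable {C : Type u} [Category.{v} C] [MonoidalCategory C]

/-- The composite of the systems `A w`, for `w` running through a list of wires. -/
def tens {W : Type} (A : W → C) : List W → C
  | [] => 𝟙_ C
  | w :: l => A w ⊗ tens A l

/-- Splitting the wires of a concatenated list. -/
def split {W : Type} (A : W → C) : ∀ l₁ l₂ : List W,
    tens A (l₁ ++ l₂) ≅ tens A l₁ ⊗ tens A l₂
  | [], l₂ => (λ_ (tens A l₂)).symm
  | w :: l₁, l₂ => whiskerLeftIso (A w) (split A l₁ l₂) ≪≫ (α_ _ _ _).symm

/-- `Extraction w l l'`: a way to obtain the list `l'` from `l` by removing one wire named `w`. -/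
inductive Extraction {W : Type} (w : W) : List W → List W → Type
  | here (l : List W) : Extraction w (w :: l) l
  | there (x : W) {l l' : List W} (e : Extraction w l l') : Extraction w (x :: l) (x :: l')

/-- `Rewiring l₁ l₂`: a bijection between the wires in `l₁` and the wires in `l₂` that respects their
names. -/
inductive Rewiring {W : Type} : List W → List W → Type
  | nil : Rewiring [] []
  | cons {w : W} {l l' t : List W} (e : Extraction w l l') (r : Rewiring l' t) :
      Rewiring l (w :: t)

/-- The event that moves the extracted wire to the front. -/
def Extraction.hom [SymmetricCategory C] {W : Type} (A : W → C) {w : W} :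
    ∀ {l l' : List W}, Extraction w l l' → (tens A l ⟶ A w ⊗ tens A l')
  | _, _, .here l => 𝟙 (A w ⊗ tens A l)
  | _, _, .there x (l := l) (l' := l') e =>
    (A x ◁ e.hom A : A x ⊗ tens A l ⟶ A x ⊗ (A w ⊗ tens A l')) ≫
      (α_ (A x) (A w) (tens A l')).inv ≫ (β_ (A x) (A w)).hom ▷ tens A l' ≫
      (α_ (A w) (A x) (tens A l')).hom

/-- The event that permutes the wires by a rewiring. -/
def Rewiring.hom [SymmetricCategory C] {W : Type} (A : W → C) :
    ∀ {l₁ l₂ : List W}, Rewiring l₁ l₂ → (tens A l₁ ⟶ tens A l₂)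
  | _, _, .nil => 𝟙 (𝟙_ C)
  | _, _, .cons (w := w) e r => e.hom A ≫ A w ◁ r.hom A

theorem Extraction.perm {W : Type} {w : W} {l l' : List W} (e : Extraction w l l') :
    l.Perm (w :: l') := by
  induction e with
  | here l => exact List.Perm.refl _
  | there x e ih => exact (ih.cons x).trans (List.Perm.swap _ _ _)

theorem Extraction.exists_of_mem {W : Type} {w : W} {l : List W} (h : w ∈ l) :
    ∃ l', Nonempty (Extraction w l l') := by
  induction l with
  | nil => exact absurd h List.not_mem_nil
  | cons x l ih =>
    rcases List.mem_cons.1 h with rfl | h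
    · exact ⟨l, ⟨.here l⟩⟩
    · obtain ⟨l', ⟨e⟩⟩ := ih h
      exact ⟨x :: l', ⟨.there x e⟩⟩

theorem Rewiring.nonempty_of_perm {W : Type} {l₁ l₂ : List W} (h : l₁.Perm l₂) :
    Nonempty (Rewiring l₁ l₂) := by
  induction l₂ generalizing l₁ with
  | nil => rw [h.eq_nil]; exact ⟨.nil⟩
  | cons w t ih =>
    obtain ⟨l', ⟨e⟩⟩ := Extraction.exists_of_mem (h.mem_iff.2 List.mem_cons_self)
    obtain ⟨r⟩ := ih (List.Perm.cons_inv (e.perm.symm.trans h))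
    exact ⟨.cons e r⟩

theorem Extraction.unique {W : Type} {w : W} {l l' l'' : List W} (hl : l.Nodup)
    (e : Extraction w l l') (f : Extraction w l l'') : l' = l'' ∧ e ≍ f := by
  induction e generalizing l'' with
  | here l =>
    cases f with
    | here => exact ⟨rfl, HEq.rfl⟩
    | there x f => exact absurd (f.perm.mem_iff.2 List.mem_cons_self) (List.nodup_cons.1 hl).1
  | there x e ih =>
    cases f with
    | here => exact absurd (e.perm.mem_iff.2 List.mem_cons_self) (List.nodup_cons.1 hl).1
    | there x f =>
      obtain ⟨rfl, h⟩ := ih (List.nodup_cons.1 hl).2 f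
      cases h
      exact ⟨rfl, HEq.rfl⟩

/-- If no name is repeated, there is only one rewiring. -/
theorem Rewiring.subsingleton_of_nodup {W : Type} {l₁ l₂ : List W} (hl : l₁.Nodup)
    (r s : Rewiring l₁ l₂) : r = s := by
  induction r with
  | nil => cases s; rfl
  | cons e r ih =>
    cases s with
    | cons f s =>
      obtain ⟨rfl, h⟩ := Extraction.unique hl e f
      cases h
      rw [ih (List.nodup_cons.1 (e.perm.nodup_iff.1 hl)).2 s]

/-- Parallel composition of states, one for each `s` in a list, the one for `s` being a state of
the wires in `out s`. -/
def parStates {W S : Type} (A : W → C) (out : S → List W)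
    (σ : ∀ s, 𝟙_ C ⟶ tens A (out s)) : ∀ l : List S, 𝟙_ C ⟶ tens A (l.flatMap out)
  | [] => 𝟙 (𝟙_ C)
  | s :: l => (λ_ (𝟙_ C)).inv ≫ (σ s ⊗ₘ parStates A out σ l) ≫
      (split A (out s) (l.flatMap out)).inv

/-- Parallel composition of effects, one for each `j` in a list, the one for `j` being an effect on
the wires in `inp j`. -/
def parEffects {W P : Type} (A : W → C) (inp : P → List W)
    (a : ∀ j, tens A (inp j) ⟶ 𝟙_ C) : ∀ l : List P, tens A (l.flatMap inp) ⟶ 𝟙_ C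
  | [] => 𝟙 (𝟙_ C)
  | j :: l => (split A (inp j) (l.flatMap inp)).hom ≫ (a j ⊗ₘ parEffects A inp a l) ≫
      (λ_ (𝟙_ C)).hom

section TwoLayer

/-! Two-layer networks: one preparation for each `s : S` and one measurement for each `j : P`, with
one wire, named `(s, j)`, from the preparation `s` to the measurement `j` for each `j ∈ inc s`. -/

variable {S P : Type}

/-- The wires leaving the preparation `s`. -/
noncomputable def outWires (inc : S → Finset P) (s : S) : List (S × P) :=
  (inc s).toList.map (fun j => (s, j))

/-- The wires entering the measurement `j`. -/
noncomputable def inWires [Fintype S] [DecidableEq P] (inc : S → Finset P) (j : P) : List (S × P) :=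
  (Finset.univ.filter (fun s => j ∈ inc s)).toList.map (fun s => (s, j))

theorem nodup_out [Fintype S] (inc : S → Finset P) :
    ((Finset.univ : Finset S).toList.flatMap (outWires inc)).Nodup := by
  rw [List.nodup_flatMap]
  refine ⟨fun s _ => (Finset.nodup_toList _).map (fun a b h => (Prod.mk.inj h).2), ?_⟩
  refine (Finset.nodup_toList _).imp ?_
  intro s t hst w hs ht
  simp only [outWires, List.mem_map] at hs ht
  obtain ⟨_, _, rfl⟩ := hs
  obtain ⟨_, _, h⟩ := ht
  exact hst (Prod.mk.inj h).1.symm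

theorem nodup_in [Fintype S] [Fintype P] [DecidableEq P] (inc : S → Finset P) :
    ((Finset.univ : Finset P).toList.flatMap (inWires inc)).Nodup := by
  rw [List.nodup_flatMap]
  refine ⟨fun s _ => (Finset.nodup_toList _).map (fun a b h => (Prod.mk.inj h).1), ?_⟩
  refine (Finset.nodup_toList _).imp ?_
  intro s t hst w hs ht
  simp only [inWires, List.mem_map] at hs ht
  obtain ⟨_, _, rfl⟩ := hs
  obtain ⟨_, _, h⟩ := ht
  exact hst (Prod.mk.inj h).2.symm

theorem perm_out_in [Fintype S] [Fintype P] [DecidableEq P] (inc : S → Finset P) :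
    ((Finset.univ : Finset S).toList.flatMap (outWires inc)).Perm
      ((Finset.univ : Finset P).toList.flatMap (inWires inc)) := by
  rw [List.perm_ext_iff_of_nodup (nodup_out inc) (nodup_in inc)]
  rintro ⟨s, j⟩
  simp [outWires, inWires]

/-- The permutation that connects each wire leaving a preparation with the wire of the same name
entering a measurement (no wire is listed twice, so there is only one). -/
noncomputable def wiring [Fintype S] [Fintype P] [DecidableEq P] (inc : S → Finset P) :
    Rewiring ((Finset.univ : Finset S).toList.flatMap (outWires inc))
      ((Finset.univ : Finset P).toList.flatMap (inWires inc)) :=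
  Classical.choice (Rewiring.nonempty_of_perm (perm_out_in inc))

/-- The closed event in which the preparations `σ s` and the effects `a j` are connected according
to the network.  By symmetry it does not depend on the order in which wires are listed. -/
noncomputable def closedEvent [SymmetricCategory C] [Fintype S] [Fintype P] [DecidableEq P]
    (inc : S → Finset P) (A : S × P → C)
    (σ : ∀ s, 𝟙_ C ⟶ tens A (outWires inc s)) (a : ∀ j, tens A (inWires inc j) ⟶ 𝟙_ C) :
    𝟙_ C ⟶ 𝟙_ C :=
  parStates A (outWires inc) σ (Finset.univ : Finset S).toList ≫
    (wiring inc).hom A ≫ parEffects A (inWires inc) a (Finset.univ : Finset P).toList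

end TwoLayer

end Circuit

open Circuit in
/-- The joint distribution `p` of variables with values in `V j` (for `j : ι`) arises, in the theory
`T`, from a generalized Bayesian network of the shape `𝒢_{n,m}` with `n = card ι`: for each subset
`I ⊆ ι` of size `m` there is a preparation test (with a single event) having one output system for
each `j ∈ I`, and the variable `j` is the outcome of a measurement test whose inputs are the `j`-th
outputs of all preparations with `j ∈ I`. -/
def ArisesFromGBN {C : Type u} [Category.{v} C] [MonoidalCategory C] [SymmetricCategory C]
    (T : OperationalTheory C) {ι : Type} [Fintype ι] [DecidableEq ι] (m : ℕ) {V : ι → Type}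
    [∀ j, Fintype (V j)] (p : stdSimplex ℝ (∀ j, V j)) : Prop :=
  let inc : {I : Finset ι // I.card = m} → Finset ι := Subtype.val
  ∃ (A : {I : Finset ι // I.card = m} × ι → C)
    (σ : ∀ I, 𝟙_ C ⟶ tens A (outWires inc I))
    (M : ∀ j, V j → (tens A (inWires inc j) ⟶ 𝟙_ C)),
    (∀ I, T.IsTest (fun _ : Unit => σ I)) ∧ (∀ j, T.IsTest (M j)) ∧
      ∀ v : ∀ j, V j, p v = T.prob (closedEvent inc A σ (fun j => M j (v j)))

/-! Replace every source `σ I` with `i ∉ I` by the product of its one-wire marginals, and keep the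
other sources and all measurements; `p'` is the resulting distribution. Ignoring an outcome amounts
to discarding the inputs of that measurement, by coarse-graining and uniqueness of the discarding
test (`IsCausal.sum_prob_closedEvent`).

For the joint marginal of `i` and `j`, the inputs of all other parties are discarded. Discarding a
composite is discarding its parts, so a source with `i ∉ I` contributes only its marginal on the
wire to `j`, or the trivial factor if it has no such wire. Breaking the source does not change this
(`IsMarginal.closedEvent_broken`).

If the outcome of `i` is ignored, the wires to `i` are discarded. A source with `i ∈ I` becomes a
deterministic state of the `m - 1` wires to the rest of `I`. The broken sources are products of
deterministic one-wire states, each of which can be absorbed into the measurement receiving it. A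
network of the required shape on the other parties remains (`IsMarginal.exists_reduced`).

The category is not assumed strict, so circuits are compared modulo permutations of named wires
(`Net`). There, parallel composition is a commutative product, and sequential composition is a
relation `Net.Comp`, single-valued when no connecting wire name is repeated, because a
duplicate-free list admits only one wire permutation to a given list (`IsPerm.eq_of_nodup`). On
closed events the quotient loses nothing (`Net.scalar_injective`), so circuit identities reduce to
regrouping finite products. -/

namespace Circuit

/-! ### Coherence of wire permutations. -/

variable {C : Type u} [Category.{v} C] [MonoidalCategory C] [SymmetricCategory C]

/-- Exchanging the first two of three systems. -/
def exch (X Y Z : C) : X ⊗ Y ⊗ Z ⟶ Y ⊗ X ⊗ Z :=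
  (α_ X Y Z).inv ≫ (β_ X Y).hom ▷ Z ≫ (α_ Y X Z).hom

theorem exch_exch (X Y Z : C) : exch X Y Z ≫ exch Y X Z = 𝟙 _ := by
  simp [exch, ← comp_whiskerRight_assoc]

theorem exch_natural (X Y : C) {Z Z' : C} (f : Z ⟶ Z') :
    exch X Y Z ≫ Y ◁ X ◁ f = X ◁ Y ◁ f ≫ exch X Y Z' := by
  simp only [exch, Category.assoc]
  rw [← associator_naturality_right, ← whisker_exchange_assoc,
    ← associator_inv_naturality_right_assoc]

theorem exch_natural_assoc (X Y : C) {Z Z' T : C} (f : Z ⟶ Z') (g : Y ⊗ X ⊗ Z' ⟶ T) :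
    exch X Y Z ≫ Y ◁ X ◁ f ≫ g = X ◁ Y ◁ f ≫ exch X Y Z' ≫ g := by
  rw [← Category.assoc, exch_natural, Category.assoc]

/-- The braid relation `BraidedCategory.yang_baxter` with a spectator system `T`, rebracketed to the
right. -/
theorem exch_yang_baxter (X Y Z T : C) :
    exch X Y (Z ⊗ T) ≫ Y ◁ exch X Z T ≫ exch Y Z (X ⊗ T) =
      X ◁ exch Y Z T ≫ exch X Z (Y ⊗ T) ≫ Z ◁ exch X Y T := by
  have h := congrArg (fun f => X ◁ (α_ Y Z T).inv ≫ (α_ X (Y ⊗ Z) T).inv ≫ f ▷ T ≫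
    (α_ Z (Y ⊗ X) T).hom ≫ Z ◁ (α_ Y X T).hom) (BraidedCategory.yang_baxter X Y Z)
  convert h using 1 <;> simp [exch]

/-- The wire permutations: events built from exchanges of neighbouring wires. -/
inductive IsPerm {W : Type} (A : W → C) : ∀ {l l' : List W}, (tens A l ⟶ tens A l') → Prop
  | id (l : List W) : IsPerm A (𝟙 (tens A l))
  | comp {l₁ l₂ l₃ : List W} {f : tens A l₁ ⟶ tens A l₂} {g : tens A l₂ ⟶ tens A l₃} :
      IsPerm A f → IsPerm A g → IsPerm A (f ≫ g)
  | cons (w : W) {l l' : List W} {f : tens A l ⟶ tens A l'} :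
      IsPerm A f → IsPerm A (l := w :: l) (l' := w :: l') (A w ◁ f)
  | swap (w x : W) (l : List W) :
      IsPerm A (l := w :: x :: l) (l' := x :: w :: l) (exch (A w) (A x) (tens A l))

variable {W : Type} {A : W → C}

theorem IsPerm.perm {l l' : List W} {f : tens A l ⟶ tens A l'} (h : IsPerm A f) : l.Perm l' := by
  induction h with
  | id l => exact .refl _
  | comp _ _ h₁ h₂ => exact h₁.trans h₂
  | cons w _ h => exact h.cons w
  | swap w x l => exact .swap _ _ _

theorem IsPerm.exists_inverse {l l' : List W} {f : tens A l ⟶ tens A l'} (h : IsPerm A f) :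
    ∃ g : tens A l' ⟶ tens A l, IsPerm A g ∧ f ≫ g = 𝟙 _ ∧ g ≫ f = 𝟙 _ := by
  induction h with
  | id l => exact ⟨_, .id l, by simp, by simp⟩
  | comp _ _ h₁ h₂ =>
    obtain ⟨g₁, p₁, e₁, e₁'⟩ := h₁
    obtain ⟨g₂, p₂, e₂, e₂'⟩ := h₂
    exact ⟨g₂ ≫ g₁, p₂.comp p₁, by simp [reassoc_of% e₂, e₁], by simp [reassoc_of% e₁', e₂']⟩
  | cons w _ h =>
    obtain ⟨g, p, e, e'⟩ := h
    refine ⟨_, p.cons w, ?_, ?_⟩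
    · exact (whiskerLeft_comp _ _ _).symm.trans ((congrArg _ e).trans (whiskerLeft_id _ _))
    · exact (whiskerLeft_comp _ _ _).symm.trans ((congrArg _ e').trans (whiskerLeft_id _ _))
  | swap w x l => exact ⟨_, .swap x w l, exch_exch _ _ _, exch_exch _ _ _⟩

theorem Extraction.isPerm {w : W} {l l' : List W} (e : Extraction w l l') :
    IsPerm A (l' := w :: l') (e.hom A) := by
  induction e with
  | here l => exact .id (w :: l)
  | there x e ih => exact (ih.cons x).comp (.swap x w _)

theorem Rewiring.isPerm {l l' : List W} (r : Rewiring l l') : IsPerm A (r.hom A) := by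
  induction r with
  | nil => exact .id []
  | cons e r ih => exact e.isPerm.comp (ih.cons _)

/-- The order of two extractions is immaterial. If one wire is at the head, this is immediate or
uses that exchanges are involutive; otherwise both pass the same head wire and the braid relation
applies. -/
theorem Extraction.exchange {w x : W} {l l' l'' : List W} (e : Extraction w l l')
    (f : Extraction x l' l'') :
    ∃ (m : List W) (f' : Extraction x l m) (e' : Extraction w m l''),
      e.hom A ≫ A w ◁ f.hom A ≫ exch (A w) (A x) (tens A l'') = f'.hom A ≫ A x ◁ e'.hom A := by
  induction e generalizing l'' with
  | here l =>
    refine ⟨_, .there w f, .here _, ?_⟩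
    simp only [Extraction.hom, exch]
    erw [whiskerLeft_id, Category.comp_id, Category.id_comp]
    rfl
  | there y e ih =>
    cases f with
    | here =>
      refine ⟨_, .here _, e, ?_⟩
      simp only [Extraction.hom]
      erw [whiskerLeft_id, Category.id_comp, Category.id_comp]
      change (A x ◁ e.hom A ≫ exch _ _ _) ≫ exch _ _ _ = _
      rw [Category.assoc, exch_exch, Category.comp_id]
    | there _ f =>
      obtain ⟨m, f', e', h⟩ := ih f
      refine ⟨_, .there y f', .there y e', ?_⟩
      change (A y ◁ e.hom A ≫ exch _ _ _) ≫ A w ◁ (A y ◁ f.hom A ≫ exch _ _ _) ≫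
        exch (A w) (A x) (A y ⊗ _) =
          (A y ◁ f'.hom A ≫ exch _ _ _) ≫ A x ◁ (A y ◁ e'.hom A ≫ exch _ _ _)
      simp only [whiskerLeft_comp, Category.assoc]
      rw [exch_natural_assoc, exch_natural_assoc, exch_yang_baxter, ← whiskerLeft_comp_assoc,
        ← whiskerLeft_comp_assoc, ← whiskerLeft_comp_assoc, Category.assoc, h]

/-- Pulls an extraction to the front of a rewiring, one use of `Extraction.exchange` per wire
passed. -/
theorem Rewiring.comp_extraction {l t t' : List W} {x : W} (r : Rewiring l t)
    (f : Extraction x t t') :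
    ∃ (l' : List W) (f' : Extraction x l l') (r' : Rewiring l' t'),
      r.hom A ≫ f.hom A = f'.hom A ≫ A x ◁ r'.hom A := by
  induction r generalizing t' with
  | nil => cases f
  | @cons w _ _ _ e r ih =>
    cases f with
    | here =>
      refine ⟨_, e, r, ?_⟩
      exact Category.comp_id _
    | there _ f =>
      obtain ⟨l', f', r', h⟩ := ih f
      obtain ⟨m, f'', e', h'⟩ := e.exchange (A := A) f'
      refine ⟨m, f'', .cons e' r', ?_⟩
      change (e.hom A ≫ A w ◁ r.hom A) ≫ A w ◁ f.hom A ≫ exch _ _ _ =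
        f''.hom A ≫ A x ◁ (e'.hom A ≫ A w ◁ r'.hom A)
      rw [whiskerLeft_comp, ← reassoc_of% h', Category.assoc, ← whiskerLeft_comp_assoc, h,
        whiskerLeft_comp_assoc, exch_natural]

theorem Rewiring.exists_comp {l t u : List W} (r : Rewiring l t) (s : Rewiring t u) :
    ∃ q : Rewiring l u, q.hom A = r.hom A ≫ s.hom A := by
  induction s generalizing l with
  | nil => exact ⟨r, (Category.comp_id _).symm⟩
  | cons f s ih =>
    obtain ⟨l', f', r', h⟩ := r.comp_extraction (A := A) f
    obtain ⟨q, hq⟩ := ih r'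
    refine ⟨.cons f' q, ?_⟩
    simp only [Rewiring.hom]
    erw [hq, whiskerLeft_comp, reassoc_of% h]
    rfl

theorem Rewiring.exists_id (l : List W) : ∃ q : Rewiring l l, q.hom A = 𝟙 (tens A l) := by
  induction l with
  | nil => exact ⟨.nil, rfl⟩
  | cons w l ih =>
    obtain ⟨q, hq⟩ := ih
    refine ⟨.cons (.here l) q, ?_⟩
    simp only [Rewiring.hom, hq, Extraction.hom]
    erw [whiskerLeft_id, Category.id_comp]
    rfl

/-- Rewirings are normal forms (selection sort): they contain identities and neighbouring exchanges,
and are closed under composition and adding a wire. -/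
theorem IsPerm.exists_rewiring {l l' : List W} {f : tens A l ⟶ tens A l'} (h : IsPerm A f) :
    ∃ r : Rewiring l l', r.hom A = f := by
  induction h with
  | id l => exact Rewiring.exists_id l
  | comp _ _ h₁ h₂ =>
    obtain ⟨r, rfl⟩ := h₁
    obtain ⟨s, rfl⟩ := h₂
    exact r.exists_comp s
  | cons w _ h =>
    obtain ⟨r, rfl⟩ := h
    exact ⟨.cons (.here _) r, Category.id_comp _⟩
  | swap w x l =>
    obtain ⟨r, hr⟩ := Rewiring.exists_id (A := A) l
    refine ⟨.cons (.there w (.here l)) (.cons (.here l) r), ?_⟩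
    simp only [Rewiring.hom, hr, Extraction.hom, exch]
    erw [whiskerLeft_id, whiskerLeft_id, Category.id_comp, Category.id_comp, whiskerLeft_id]
    exact Category.comp_id _

/-- If no name is repeated, there is only one wire permutation. -/
theorem IsPerm.eq_of_nodup {l l' : List W} (hl : l.Nodup) {f g : tens A l ⟶ tens A l'}
    (hf : IsPerm A f) (hg : IsPerm A g) : f = g := by
  obtain ⟨r, rfl⟩ := hf.exists_rewiring
  obtain ⟨s, rfl⟩ := hg.exists_rewiring
  rw [Rewiring.subsingleton_of_nodup hl r s]

theorem IsPerm.exists_of_perm {l l' : List W} (h : l.Perm l') :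
    ∃ f : tens A l ⟶ tens A l', IsPerm A f := by
  obtain ⟨r⟩ := Rewiring.nonempty_of_perm h
  exact ⟨_, r.isPerm⟩

theorem IsPerm.eq_id_of_nil {f : tens A ([] : List W) ⟶ tens A []} (h : IsPerm A f) :
    f = 𝟙 (𝟙_ C) :=
  h.eq_of_nodup List.nodup_nil (.id [])

end Circuit

/-! ### Parallel composition and regrouping of wire lists. -/

namespace Circuit

section Coherence

variable {C : Type u} [Category.{v} C] [MonoidalCategory C]

/-- Here and below, arbitrary isomorphisms stand for instances of `split`. The identities are then
plain monoidal coherence, and they match base cases and inductive steps over lists definitionally.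
-/
theorem splitCons_whiskerRight (X : C) {L L' T U U' : C} (s : U ≅ L ⊗ T) (s' : U' ≅ L' ⊗ T)
    (f : L ⟶ L') :
    (X ◁ s.hom ≫ (α_ X L T).inv) ≫ (X ◁ f ⊗ₘ 𝟙 T) ≫ (α_ X L' T).hom ≫ X ◁ s'.inv =
      X ◁ (s.hom ≫ (f ⊗ₘ 𝟙 T) ≫ s'.inv) := by
  simp

theorem splitCons_whiskerLeft (X : C) {L T T' U U' : C} (s : U ≅ L ⊗ T) (s' : U' ≅ L ⊗ T')
    (g : T ⟶ T') :
    (X ◁ s.hom ≫ (α_ X L T).inv) ≫ (𝟙 (X ⊗ L) ⊗ₘ g) ≫ (α_ X L T').hom ≫ X ◁ s'.inv =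
      X ◁ (s.hom ≫ (𝟙 L ⊗ₘ g) ≫ s'.inv) := by
  simp

theorem splitCons_rightUnitor (X : C) {L U : C} (s : U ≅ L ⊗ 𝟙_ C) :
    (X ◁ s.hom ≫ (α_ X L (𝟙_ C)).inv) ≫ (ρ_ (X ⊗ L)).hom = X ◁ (s.hom ≫ (ρ_ L).hom) := by
  simp

theorem splitNil_reassoc {L T U : C} (s : U ≅ L ⊗ T) :
    s.hom ≫ (λ_ L).inv ▷ T ≫ (α_ (𝟙_ C) L T).hom ≫ 𝟙_ C ◁ s.inv ≫ (λ_ U).hom = 𝟙 U := by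
  simp

theorem splitCons_reassoc (X : C) {L₁ L₂ L₃ U V Y Z : C} (s : U ≅ L₁ ⊗ L₂) (s' : V ≅ U ⊗ L₃)
    (t : Y ≅ L₂ ⊗ L₃) (t' : Z ≅ L₁ ⊗ Y) :
    (X ◁ s'.hom ≫ (α_ X U L₃).inv) ≫ (X ◁ s.hom ≫ (α_ X L₁ L₂).inv) ▷ L₃ ≫
      (α_ (X ⊗ L₁) L₂ L₃).hom ≫ (X ⊗ L₁) ◁ t.inv ≫ (α_ X L₁ Y).hom ≫ X ◁ t'.inv =
    X ◁ (s'.hom ≫ s.hom ▷ L₃ ≫ (α_ L₁ L₂ L₃).hom ≫ L₁ ◁ t.inv ≫ t'.inv) := by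
  simp

theorem par_comp_rightUnitor {L L' U U' : C} (s : U ≅ L ⊗ 𝟙_ C) (s' : U' ≅ L' ⊗ 𝟙_ C)
    (f : L ⟶ L') :
    (s.hom ≫ (f ⊗ₘ 𝟙 _) ≫ s'.inv) ≫ s'.hom ≫ (ρ_ L').hom = (s.hom ≫ (ρ_ L).hom) ≫ f := by
  simp

theorem leftUnitor_conj {L L' : C} (f : L ⟶ L') :
    (λ_ L).inv ≫ (𝟙 (𝟙_ C) ⊗ₘ f) ≫ (λ_ L').hom = f := by
  simp

variable [SymmetricCategory C]

theorem exch_whiskerRight (X Y : C) {L T U : C} (s : U ≅ L ⊗ T) :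
    (X ◁ (Y ◁ s.hom ≫ (α_ Y L T).inv) ≫ (α_ X (Y ⊗ L) T).inv) ≫ (exch X Y L ⊗ₘ 𝟙 T) ≫
      (α_ Y (X ⊗ L) T).hom ≫ Y ◁ ((α_ X L T).hom ≫ X ◁ s.inv) = exch X Y U := by
  have h : (X ◁ (Y ◁ s.hom ≫ (α_ Y L T).inv) ≫ (α_ X (Y ⊗ L) T).inv) ≫ (exch X Y L ⊗ₘ 𝟙 T) ≫
      (α_ Y (X ⊗ L) T).hom ≫ Y ◁ (α_ X L T).hom = X ◁ Y ◁ s.hom ≫ exch X Y (L ⊗ T) := by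
    simp [exch]
  have h' := congrArg (fun f => f ≫ Y ◁ X ◁ s.inv) h
  simp only [Category.assoc, exch_natural, ← whiskerLeft_comp, ← whiskerLeft_comp_assoc,
    s.hom_inv_id] at h'
  simpa only [Category.assoc, whiskerLeft_comp, whiskerLeft_id, Category.id_comp] using h'

theorem splitNil_exch (X T : C) :
    X ◁ (λ_ T).inv ≫ exch X (𝟙_ C) T ≫ (λ_ (X ⊗ T)).hom = 𝟙 _ := by
  simp [exch, braiding_tensorUnit_right]

theorem splitCons_exch (X Y : C) {L T U U' : C} (s : U ≅ L ⊗ T) (s' : U' ≅ L ⊗ X ⊗ T) :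
    X ◁ (Y ◁ s.hom ≫ (α_ Y L T).inv) ≫ exch X (Y ⊗ L) T ≫
      (α_ Y L (X ⊗ T)).hom ≫ Y ◁ s'.inv =
    exch X Y U ≫ Y ◁ (X ◁ s.hom ≫ exch X L T ≫ s'.inv) := by
  simp only [whiskerLeft_comp, Category.assoc, exch_natural_assoc]
  congr 1
  simp [exch]

theorem splitNil_braiding {L U : C} (s : U ≅ L ⊗ 𝟙_ C) :
    (s.hom ≫ (ρ_ L).hom) ≫ (λ_ L).inv ≫ (β_ (𝟙_ C) L).hom ≫ s.inv = 𝟙 _ := by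
  simp [braiding_tensorUnit_left]

theorem splitCons_braiding (X : C) {L L₂ U U' V : C} (s : U ≅ L ⊗ L₂) (s' : U' ≅ L₂ ⊗ L)
    (t : V ≅ L₂ ⊗ X ⊗ L) :
    (X ◁ s.hom ≫ (α_ X L L₂).inv) ≫ (β_ (X ⊗ L) L₂).hom ≫ t.inv =
      X ◁ (s.hom ≫ (β_ L L₂).hom ≫ s'.inv) ≫ X ◁ s'.hom ≫ exch X L₂ L ≫ t.inv := by
  simp [exch]

end Coherence

variable {C : Type u} [Category.{v} C] [MonoidalCategory C] {W : Type} (A : W → C)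

/-- Parallel composition of events between lists of wires. -/
def par {l₁ l₂ l₃ l₄ : List W} (f : tens A l₁ ⟶ tens A l₂) (g : tens A l₃ ⟶ tens A l₄) :
    tens A (l₁ ++ l₃) ⟶ tens A (l₂ ++ l₄) :=
  (split A l₁ l₃).hom ≫ (f ⊗ₘ g) ≫ (split A l₂ l₄).inv

variable {A}

theorem par_comp {l₁ l₂ l₃ k₁ k₂ k₃ : List W} (f : tens A l₁ ⟶ tens A l₂)
    (f' : tens A l₂ ⟶ tens A l₃) (g : tens A k₁ ⟶ tens A k₂) (g' : tens A k₂ ⟶ tens A k₃) :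
    par A (f ≫ f') (g ≫ g') = par A f g ≫ par A f' g' := by
  simp [par]

theorem par_id (l₁ l₂ : List W) : par A (𝟙 (tens A l₁)) (𝟙 (tens A l₂)) = 𝟙 _ := by
  simp [par]

theorem par_nil_left {l₃ l₄ : List W} (g : tens A l₃ ⟶ tens A l₄) :
    par A (l₁ := []) (l₂ := []) (𝟙 _) g = g :=
  leftUnitor_conj g

variable (A)

/-- Removing an empty list of wires on the right. -/
def unitR (l : List W) : tens A (l ++ []) ⟶ tens A l :=
  (split A l []).hom ≫ (ρ_ (tens A l)).hom

/-- Regrouping three lists of wires. -/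
def reassocR (l₁ l₂ l₃ : List W) : tens A ((l₁ ++ l₂) ++ l₃) ⟶ tens A (l₁ ++ (l₂ ++ l₃)) :=
  (split A (l₁ ++ l₂) l₃).hom ≫ (split A l₁ l₂).hom ▷ _ ≫ (α_ _ _ _).hom ≫
    _ ◁ (split A l₂ l₃).inv ≫ (split A l₁ (l₂ ++ l₃)).inv

variable {A}

theorem par_unitR {l l' : List W} (f : tens A l ⟶ tens A l') :
    par A (l₃ := []) (l₄ := []) f (𝟙 _) ≫ unitR A l' = unitR A l ≫ f :=
  par_comp_rightUnitor (split A l []) (split A l' []) f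

theorem par_reassocR {l₁ l₂ l₃ k₁ k₂ k₃ : List W} (f : tens A l₁ ⟶ tens A k₁)
    (g : tens A l₂ ⟶ tens A k₂) (h : tens A l₃ ⟶ tens A k₃) :
    par A (par A f g) h ≫ reassocR A k₁ k₂ k₃ = reassocR A l₁ l₂ l₃ ≫ par A f (par A g h) := by
  have e : ((split A l₁ l₂).hom ≫ (f ⊗ₘ g)) ⊗ₘ h =
      ((split A l₁ l₂).hom ⊗ₘ 𝟙 _) ≫ ((f ⊗ₘ g) ⊗ₘ h) := by
    rw [tensorHom_comp_tensorHom, Category.id_comp]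
  have e' : f ⊗ₘ ((g ⊗ₘ h) ≫ (split A k₂ k₃).inv) =
      (f ⊗ₘ (g ⊗ₘ h)) ≫ (𝟙 _ ⊗ₘ (split A k₂ k₃).inv) := by
    rw [tensorHom_comp_tensorHom, Category.comp_id]
  simp only [par, reassocR, ← tensorHom_id, ← id_tensorHom, Category.assoc,
    Iso.inv_hom_id_assoc, tensorHom_comp_tensorHom_assoc,
    Iso.inv_hom_id, Category.comp_id, Category.id_comp]
  rw [e, e', Category.assoc, Category.assoc, associator_naturality_assoc]

variable [SymmetricCategory C]

theorem IsPerm.of_eq {l l' : List W} {f g : tens A l ⟶ tens A l'} (h : IsPerm A f) (e : g = f) :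
    IsPerm A g :=
  e ▸ h

theorem IsPerm.par_id {l₁ l₁' : List W} {f : tens A l₁ ⟶ tens A l₁'} (h : IsPerm A f)
    (l₂ : List W) : IsPerm A (par A f (𝟙 (tens A l₂))) := by
  induction h with
  | id l => rw [Circuit.par_id]; exact .id _
  | comp _ _ h₁ h₂ =>
    rw [← Category.id_comp (𝟙 (tens A l₂)), par_comp]
    exact h₁.comp h₂
  | @cons w l l' f _ h =>
    exact (h.cons w).of_eq (splitCons_whiskerRight (A w) (split A l l₂) (split A l' l₂) f)
  | swap w x l =>
    exact (IsPerm.swap w x (l ++ l₂)).of_eq (exch_whiskerRight (A w) (A x) (split A l l₂))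

theorem IsPerm.id_par {l₂ l₂' : List W} {g : tens A l₂ ⟶ tens A l₂'} (h : IsPerm A g)
    (l₁ : List W) : IsPerm A (par A (𝟙 (tens A l₁)) g) := by
  induction l₁ with
  | nil => exact (par_nil_left g).symm ▸ h
  | cons w l ih =>
    exact (ih.cons w).of_eq (splitCons_whiskerLeft (A w) (split A l l₂) (split A l l₂') g)

theorem IsPerm.par {l₁ l₁' l₂ l₂' : List W} {f : tens A l₁ ⟶ tens A l₁'}
    {g : tens A l₂ ⟶ tens A l₂'} (hf : IsPerm A f) (hg : IsPerm A g) :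
    IsPerm A (par A f g) := by
  rw [← Category.comp_id f, ← Category.id_comp g, par_comp]
  exact (hf.par_id _).comp (hg.id_par _)

variable (A)

/-- Exchanging two lists of wires. -/
def swapLists (l₁ l₂ : List W) : tens A (l₁ ++ l₂) ⟶ tens A (l₂ ++ l₁) :=
  (split A l₁ l₂).hom ≫ (β_ (tens A l₁) (tens A l₂)).hom ≫ (split A l₂ l₁).inv

variable {A}

theorem par_swapLists {l₁ l₂ k₁ k₂ : List W} (f : tens A l₁ ⟶ tens A k₁)
    (g : tens A l₂ ⟶ tens A k₂) :
    par A f g ≫ swapLists A k₁ k₂ = swapLists A l₁ l₂ ≫ par A g f := by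
  simp [par, swapLists]

theorem isPerm_unitR (l : List W) : IsPerm A (unitR A l) := by
  induction l with
  | nil =>
    refine (IsPerm.id (A := A) []).of_eq (?_ : (λ_ (𝟙_ C)).inv ≫ (ρ_ (𝟙_ C)).hom = 𝟙 (𝟙_ C))
    rw [← unitors_equal, Iso.inv_hom_id]
  | cons w l ih => exact (ih.cons w).of_eq (splitCons_rightUnitor (A w) (split A l []))

theorem isPerm_reassocR (l₁ l₂ l₃ : List W) : IsPerm A (reassocR A l₁ l₂ l₃) := by
  induction l₁ with
  | nil => exact (IsPerm.id (A := A) (l₂ ++ l₃)).of_eq (splitNil_reassoc (split A l₂ l₃))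
  | cons w l ih =>
    exact (ih.cons w).of_eq (splitCons_reassoc (A w) (split A l l₂) (split A (l ++ l₂) l₃)
      (split A l₂ l₃) (split A l (l₂ ++ l₃)))

/-- Moving a wire behind a list of wires. -/
theorem isPerm_move (w : W) (l₂ l₃ : List W) :
    IsPerm A (l := w :: (l₂ ++ l₃)) (l' := l₂ ++ w :: l₃)
      (A w ◁ (split A l₂ l₃).hom ≫ exch (A w) (tens A l₂) (tens A l₃) ≫
        (split A l₂ (w :: l₃)).inv) := by
  induction l₂ with
  | nil => exact (IsPerm.id (A := A) (w :: l₃)).of_eq (splitNil_exch (A w) (tens A l₃))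
  | cons x l ih =>
    exact ((IsPerm.swap (A := A) w x (l ++ l₃)).comp (ih.cons x)).of_eq
      (splitCons_exch (A w) (A x) (split A l l₃) (split A l (w :: l₃)))

theorem isPerm_swapLists (l₁ l₂ : List W) : IsPerm A (swapLists A l₁ l₂) := by
  induction l₁ with
  | nil =>
    -- Braiding with the unit is trivial, so this swap is the inverse of `unitR`, and inverses of
    -- wire permutations are wire permutations.
    obtain ⟨g, hg, h, h'⟩ := (isPerm_unitR (A := A) l₂).exists_inverse
    refine hg.of_eq ?_
    have e : unitR A l₂ ≫ swapLists A [] l₂ = 𝟙 _ := splitNil_braiding (split A l₂ [])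
    calc swapLists A [] l₂ = (g ≫ unitR A l₂) ≫ swapLists A [] l₂ := by
          rw [h']; exact (Category.id_comp _).symm
      _ = g ≫ unitR A l₂ ≫ swapLists A [] l₂ := Category.assoc _ _ _
      _ = g := (congrArg (g ≫ ·) e).trans (Category.comp_id _)
  | cons w l ih =>
    exact ((ih.cons w).comp (isPerm_move w l₂ l)).of_eq
      (splitCons_braiding (A w) (split A l l₂) (split A l₂ l) (split A l₂ (w :: l)))

end Circuit

/-! ### Nets: events modulo wire permutations. -/

namespace Circuit

variable {C : Type u} [Category.{v} C] [MonoidalCategory C] [SymmetricCategory C] {W : Type}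

/-- An event together with the lists of its input wires and of its output wires. -/
structure Diagram (A : W → C) where
  inp : List W
  out : List W
  hom : tens A inp ⟶ tens A out

/-- Diagrams that differ only by permutations of the input and output wires. -/
instance Diagram.setoid (A : W → C) : Setoid (Diagram A) where
  r f g := ∃ (a : tens A f.inp ⟶ tens A g.inp) (b : tens A f.out ⟶ tens A g.out),
    IsPerm A a ∧ IsPerm A b ∧ f.hom ≫ b = a ≫ g.hom
  iseqv := by
    refine ⟨fun f => ⟨_, _, .id _, .id _, by simp⟩, ?_, ?_⟩
    · rintro f g ⟨a, b, ha, hb, h⟩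
      obtain ⟨a', ha', e₁, e₂⟩ := ha.exists_inverse
      obtain ⟨b', hb', e₃, e₄⟩ := hb.exists_inverse
      refine ⟨a', b', ha', hb', ?_⟩
      calc g.hom ≫ b' = a' ≫ a ≫ g.hom ≫ b' := by rw [reassoc_of% e₂]
        _ = a' ≫ f.hom := by rw [← reassoc_of% h, e₃, Category.comp_id]
    · rintro f g k ⟨a, b, ha, hb, h⟩ ⟨a', b', ha', hb', h'⟩
      exact ⟨a ≫ a', b ≫ b', ha.comp ha', hb.comp hb', by
        rw [reassoc_of% h, h', Category.assoc]⟩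

/-- Events with named input and output wires, up to the order of the wires. -/
def Net (A : W → C) := Quotient (Diagram.setoid A)

namespace Net

variable {A : W → C}

/-- The class of an event with given lists of wires. -/
def mk {l l' : List W} (f : tens A l ⟶ tens A l') : Net A := Quotient.mk _ ⟨l, l', f⟩

theorem ind {p : Net A → Prop}
    (h : ∀ {l l' : List W} (f : tens A l ⟶ tens A l'), p (mk f)) (x : Net A) : p x :=
  Quotient.ind (fun f => h f.hom) x

theorem mk_eq_mk {l l' k k' : List W} {f : tens A l ⟶ tens A l'} {g : tens A k ⟶ tens A k'} :
    mk f = mk g ↔ ∃ (a : tens A l ⟶ tens A k) (b : tens A l' ⟶ tens A k'),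
      IsPerm A a ∧ IsPerm A b ∧ f ≫ b = a ≫ g :=
  Quotient.eq

theorem mk_comp_isPerm {l l' k : List W} (f : tens A l ⟶ tens A l') {b : tens A l' ⟶ tens A k}
    (hb : IsPerm A b) : mk (f ≫ b) = mk f :=
  (mk_eq_mk.2 ⟨_, b, .id _, hb, (Category.id_comp _).symm⟩).symm

theorem mk_isPerm_comp {l l' k : List W} {a : tens A k ⟶ tens A l} (ha : IsPerm A a)
    (f : tens A l ⟶ tens A l') : mk (a ≫ f) = mk f :=
  mk_eq_mk.2 ⟨a, _, ha, .id _, Category.comp_id _⟩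

instance : One (Net A) := ⟨mk (l := []) (l' := []) (𝟙 (𝟙_ C))⟩

instance : Mul (Net A) :=
  ⟨Quotient.map₂ (fun f g => ⟨f.inp ++ g.inp, f.out ++ g.out, par A f.hom g.hom⟩) (by
    rintro f f' ⟨a, b, ha, hb, h⟩ g g' ⟨a', b', ha', hb', h'⟩
    exact ⟨par A a a', par A b b', ha.par ha', hb.par hb', by
      rw [← par_comp, ← par_comp, h, h']⟩)⟩

theorem mk_mul_mk {l l' k k' : List W} (f : tens A l ⟶ tens A l') (g : tens A k ⟶ tens A k') :
    mk f * mk g = mk (par A f g) := rfl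

/-- Associators, unitors and braidings of wire lists are themselves wire permutations, so they
vanish in the quotient. -/
instance : CommMonoid (Net A) where
  mul_assoc x y z := by
    induction x using ind with | _ f => ?_
    induction y using ind with | _ g => ?_
    induction z using ind with | _ h => ?_
    exact mk_eq_mk.2 ⟨_, _, isPerm_reassocR _ _ _, isPerm_reassocR _ _ _, par_reassocR f g h⟩
  one_mul x := by
    induction x using ind with | _ f => ?_
    exact congrArg mk (par_nil_left f)
  mul_one x := by
    induction x using ind with | _ f => ?_
    exact mk_eq_mk.2 ⟨_, _, isPerm_unitR _, isPerm_unitR _, par_unitR f⟩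
  mul_comm x y := by
    induction x using ind with | _ f => ?_
    induction y using ind with | _ g => ?_
    exact mk_eq_mk.2 ⟨_, _, isPerm_swapLists _ _, isPerm_swapLists _ _, par_swapLists f g⟩

/-- The input wires. -/
def dom : Net A → Multiset W :=
  Quotient.lift (fun f => (f.inp : Multiset W)) (by
    rintro f g ⟨a, b, ha, hb, h⟩
    exact Quotient.sound ha.perm)

/-- The output wires. -/
def cod : Net A → Multiset W :=
  Quotient.lift (fun f => (f.out : Multiset W)) (by
    rintro f g ⟨a, b, ha, hb, h⟩
    exact Quotient.sound hb.perm)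

@[simp] theorem dom_mk {l l' : List W} (f : tens A l ⟶ tens A l') : (mk f).dom = l := rfl
@[simp] theorem cod_mk {l l' : List W} (f : tens A l ⟶ tens A l') : (mk f).cod = l' := rfl
@[simp] theorem cod_one : (1 : Net A).cod = 0 := rfl

@[simp] theorem dom_mul (x y : Net A) : (x * y).dom = x.dom + y.dom := by
  induction x using ind with | _ f => ?_
  induction y using ind with | _ g => rfl

@[simp] theorem cod_mul (x y : Net A) : (x * y).cod = x.cod + y.cod := by
  induction x using ind with | _ f => ?_
  induction y using ind with | _ g => rfl

@[simp] theorem dom_prod {ι : Type*} (s : Finset ι) (x : ι → Net A) :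
    (∏ i ∈ s, x i).dom = ∑ i ∈ s, (x i).dom := by
  classical
  induction s using Finset.induction_on with
  | empty => rfl
  | insert i s hi ih => rw [Finset.prod_insert hi, Finset.sum_insert hi, dom_mul, ih]

@[simp] theorem cod_prod {ι : Type*} (s : Finset ι) (x : ι → Net A) :
    (∏ i ∈ s, x i).cod = ∑ i ∈ s, (x i).cod := by
  classical
  induction s using Finset.induction_on with
  | empty => rfl
  | insert i s hi ih => rw [Finset.prod_insert hi, Finset.sum_insert hi, cod_mul, ih]

theorem exists_eq_mk (x : Net A) {l l' : List W} (h : x.dom = l) (h' : x.cod = l') :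
    ∃ f : tens A l ⟶ tens A l', mk f = x := by
  induction x using ind with | _ f => ?_
  obtain ⟨a, ha⟩ := IsPerm.exists_of_perm (A := A) (Quotient.exact h.symm)
  obtain ⟨b, hb⟩ := IsPerm.exists_of_perm (A := A) (Quotient.exact h')
  exact ⟨a ≫ f ≫ b, by rw [mk_isPerm_comp ha, mk_comp_isPerm f hb]⟩

theorem exists_eq_mk_of_dom (x : Net A) {l : List W} (h : x.dom = l) :
    ∃ (l' : List W) (f : tens A l ⟶ tens A l'), mk f = x :=
  ⟨_, x.exists_eq_mk h (Multiset.coe_toList x.cod).symm⟩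

/-- The class of a state. -/
def state {l : List W} (σ : 𝟙_ C ⟶ tens A l) : Net A := mk (l := []) σ

/-- The class of an effect. -/
def effect {l : List W} (a : tens A l ⟶ 𝟙_ C) : Net A := mk (l' := []) a

variable (A) in
/-- The class of a closed event. -/
def scalar (s : 𝟙_ C ⟶ 𝟙_ C) : Net A := mk (l := []) (l' := []) s

@[simp] theorem cod_state {l : List W} (σ : 𝟙_ C ⟶ tens A l) : (state σ).cod = l := rfl
@[simp] theorem dom_effect {l : List W} (a : tens A l ⟶ 𝟙_ C) : (effect a).dom = l := rfl

theorem exists_eq_state (x : Net A) {l : List W} (h : x.dom = 0) (h' : x.cod = l) :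
    ∃ σ : 𝟙_ C ⟶ tens A l, state σ = x :=
  x.exists_eq_mk (l := []) h h'

theorem exists_eq_effect (x : Net A) {l : List W} (h : x.dom = l) (h' : x.cod = 0) :
    ∃ a : tens A l ⟶ 𝟙_ C, effect a = x :=
  x.exists_eq_mk (l' := []) h h'

/-- The empty list has only the identity permutation, so equality of nets gives back equality of
closed events. -/
theorem scalar_injective : Function.Injective (scalar A) := by
  intro s t h
  obtain ⟨a, b, ha, hb, e⟩ := mk_eq_mk.1 h
  rw [ha.eq_id_of_nil, hb.eq_id_of_nil] at e
  exact (Category.comp_id _).symm.trans (e.trans (Category.id_comp _))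

variable (A) in
/-- The identity on a collection of wires. -/
noncomputable def ident (M : Multiset W) : Net A := mk (𝟙 (tens A M.toList))

theorem ident_coe (l : List W) : ident A (l : Multiset W) = mk (𝟙 (tens A l)) := by
  obtain ⟨a, ha⟩ := IsPerm.exists_of_perm (A := A)
    (Quotient.exact (Multiset.coe_toList (l : Multiset W)))
  exact mk_eq_mk.2 ⟨a, a, ha, ha, by simp⟩

@[simp] theorem dom_ident (M : Multiset W) : (ident A M).dom = M := Multiset.coe_toList M
@[simp] theorem cod_ident (M : Multiset W) : (ident A M).cod = M := Multiset.coe_toList M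

theorem ident_zero : ident A 0 = 1 := ident_coe []

theorem ident_add (M N : Multiset W) : ident A (M + N) = ident A M * ident A N := by
  induction M using Quotient.inductionOn with | _ l => ?_
  induction N using Quotient.inductionOn with | _ k => ?_
  change ident A ((l ++ k : List W) : Multiset W) =
    ident A (l : Multiset W) * ident A (k : Multiset W)
  rw [ident_coe, ident_coe, ident_coe, mk_mul_mk, par_id]

theorem ident_sum {ι : Type*} (s : Finset ι) (M : ι → Multiset W) :
    ident A (∑ i ∈ s, M i) = ∏ i ∈ s, ident A (M i) := by
  classical
  induction s using Finset.induction_on with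
  | empty => exact ident_zero
  | insert i s hi ih => rw [Finset.prod_insert hi, Finset.sum_insert hi, ident_add, ih]

/-- `Comp x y z`: the sequential composition of `x` and `y`, along wires with the same names,
is `z`. -/
inductive Comp : Net A → Net A → Net A → Prop
  | mk {l₁ l₂ l₃ : List W} (f : tens A l₁ ⟶ tens A l₂) (g : tens A l₂ ⟶ tens A l₃) :
      Comp (mk f) (mk g) (mk (f ≫ g))

theorem Comp.dom_eq {x y z : Net A} (h : Comp x y z) : z.dom = x.dom := by cases h; rfl
theorem Comp.cod_eq {x y z : Net A} (h : Comp x y z) : z.cod = y.cod := by cases h; rfl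
theorem Comp.mid_eq {x y z : Net A} (h : Comp x y z) : x.cod = y.dom := by cases h; rfl

theorem Comp.exists {x y : Net A} (h : x.cod = y.dom) : ∃ z, Comp x y z := by
  induction x using ind with | @h l l' f => ?_
  obtain ⟨_, g, rfl⟩ := y.exists_eq_mk_of_dom h.symm
  exact ⟨_, .mk f g⟩

theorem Comp.mul {x y z x' y' z' : Net A} (h : Comp x y z) (h' : Comp x' y' z') :
    Comp (x * x') (y * y') (z * z') := by
  cases h with | mk f g => ?_
  cases h' with | mk f' g' => ?_
  rw [mk_mul_mk, mk_mul_mk, mk_mul_mk, par_comp]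
  exact .mk _ _

/-- Changing representatives permutes the connecting wires once for `x` and once for `y`; without
repeated names these two permutations coincide and cancel. -/
theorem Comp.unique {x y z z' : Net A} (hx : x.cod.Nodup) (h : Comp x y z) (h' : Comp x y z') :
    z = z' := by
  cases h with | mk f g => ?_
  generalize hX : Net.mk f = X at h'
  generalize hY : Net.mk g = Y at h'
  cases h' with | mk f' g' => ?_
  obtain ⟨a, b, ha, hb, e⟩ := mk_eq_mk.1 hX
  obtain ⟨b', c, hb', hc, e'⟩ := mk_eq_mk.1 hY
  obtain rfl := hb.eq_of_nodup (Multiset.coe_nodup.1 hx) hb'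
  exact mk_eq_mk.2 ⟨a, c, ha, hc, by rw [Category.assoc, e', reassoc_of% e]⟩

theorem Comp.ident_right (x : Net A) : Comp x (ident A x.cod) x := by
  induction x using ind with | _ f => ?_
  rw [cod_mk, ident_coe]
  simpa using Comp.mk f (𝟙 _)

theorem Comp.ident_left (x : Net A) : Comp (ident A x.dom) x x := by
  induction x using ind with | _ f => ?_
  rw [dom_mk, ident_coe]
  simpa using Comp.mk (𝟙 _) f

theorem Comp.one_one : Comp (1 : Net A) 1 1 := by
  simpa [ident_zero] using Comp.ident_right (1 : Net A)

theorem Comp.prod {ι : Type*} (s : Finset ι) {x y z : ι → Net A}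
    (h : ∀ i ∈ s, Comp (x i) (y i) (z i)) :
    Comp (∏ i ∈ s, x i) (∏ i ∈ s, y i) (∏ i ∈ s, z i) := by
  classical
  induction s using Finset.induction_on with
  | empty => exact .one_one
  | insert i s hi ih =>
    rw [Finset.prod_insert hi, Finset.prod_insert hi, Finset.prod_insert hi]
    exact (h i (Finset.mem_insert_self _ _)).mul
      (ih fun j hj => h j (Finset.mem_insert_of_mem hj))

/-- Associativity of sequential composition. -/
theorem Comp.assoc {x y z k m n : Net A} (hx : x.cod.Nodup) (hy : y.cod.Nodup)
    (h : Comp x y z) (h' : Comp z k m) (h'' : Comp y k n) : Comp x n m := by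
  cases h with | @mk l₁ l₂ l₃ f g => ?_
  obtain ⟨_, k', rfl⟩ := k.exists_eq_mk_of_dom h''.mid_eq.symm
  rw [h''.unique hy (.mk g k'), h'.unique (x := Net.mk (f ≫ g)) hy (.mk (f ≫ g) k'),
    Category.assoc]
  exact .mk _ _

/-- Discarding part of the outputs of `x` by an effect `e` first. -/
theorem Comp.slide_effect {x x' e y f s : Net A} {M : Multiset W} (he : e.cod = 0)
    (hx : (x * y).cod.Nodup) (h : Comp x (e * ident A M) x') (h' : Comp (x' * y) f s) :
    Comp (x * y) (e * f) s := by
  have hM : f.dom = M + y.cod := by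
    have := h.cod_eq
    rw [← h'.mid_eq, cod_mul, this]
    simp [he]
  -- First `e` acts on part of `x` while `y` passes through. Since `e` has no outputs, running `f`
  -- afterwards is the same as running it beside `e`.
  have h₁ : Comp (x * y) ((e * ident A M) * ident A y.cod) (x' * y) := h.mul (.ident_right y)
  have h₂ : Comp ((e * ident A M) * ident A y.cod) f (e * f) := by
    rw [mul_assoc, ← ident_add, ← hM]
    have h₃ : Comp e 1 e := by simpa [he, ident_zero] using Comp.ident_right e
    simpa using h₃.mul (.ident_left f)
  refine h₁.assoc hx (Multiset.nodup_of_le ?_ hx) h' h₂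
  rw [cod_mul, cod_mul, cod_mul, h.mid_eq, dom_mul, he, zero_add, cod_ident, cod_ident, dom_ident,
    add_assoc]
  exact Multiset.le_add_left _ _

theorem Comp.assoc' {x y z k n s : Net A} (hx : x.cod.Nodup) (hy : y.cod.Nodup)
    (h : Comp x y z) (h' : Comp y k n) (h'' : Comp x n s) : Comp z k s := by
  cases h with | @mk l₁ l₂ l₃ f g => ?_
  obtain ⟨_, k', rfl⟩ := k.exists_eq_mk_of_dom h'.mid_eq.symm
  obtain rfl := h'.unique hy (.mk g k')
  obtain rfl := h''.unique hx (.mk f (g ≫ k'))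
  rw [← Category.assoc]
  exact .mk _ _

/-- Absorbing a state `x` into a later event first. -/
theorem Comp.slide_state {x y e e' s : Net A} {M : Multiset W} (hx : x.dom = 0)
    (hn : (x * y).cod.Nodup) (hy : y.cod = M) (h : Comp (x * ident A M) e e') (h' : Comp y e' s) :
    Comp (x * y) e s := by
  subst hy
  -- Prepare `y` alone, then add `x` beside it; `x` can then be grouped with `e`.
  have h₁ : Comp 1 x x := by simpa [hx, ident_zero] using Comp.ident_left x
  have h₂ : Comp (1 * y) (x * ident A y.cod) (x * y) := h₁.mul (.ident_right y)
  rw [one_mul] at h₂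
  have hn' := hn
  rw [cod_mul] at hn'
  refine h₂.assoc' (Multiset.nodup_of_le (Multiset.le_add_left _ _) hn') ?_ h h'
  rwa [cod_mul, cod_ident]

end Net

end Circuit

/-! ### Renaming wires, and closed events as composites of nets. -/

namespace Circuit

section Coherence

variable {C : Type u} [Category.{v} C] [MonoidalCategory C]

theorem splitNil_map {L L' : C} (t : L ≅ L') :
    t.inv ≫ (λ_ L).inv ≫ (𝟙 (𝟙_ C) ⊗ₘ t.hom) ≫ (λ_ L').hom = 𝟙 L' := by
  rw [leftUnitor_conj, t.inv_hom_id]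

theorem splitCons_map (X : C) {L L' K K' U U' V : C} (t : U ≅ U') (s : U ≅ L ⊗ K) (a : L ⟶ L')
    (b : K ⟶ K') (s' : V ≅ L' ⊗ K') :
    X ◁ t.inv ≫ (X ◁ s.hom ≫ (α_ X L K).inv) ≫ (X ◁ a ⊗ₘ b) ≫ (α_ X L' K').hom ≫ X ◁ s'.inv =
      X ◁ (t.inv ≫ s.hom ≫ (a ⊗ₘ b) ≫ s'.inv) := by
  simp [MonoidalCategory.tensorHom_def]

variable [SymmetricCategory C]

theorem exch_conj (X Y : C) {L L' : C} (t : L ≅ L') :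
    X ◁ Y ◁ t.inv ≫ exch X Y L ≫ Y ◁ X ◁ t.hom = exch X Y L' := by
  rw [exch_natural, ← whiskerLeft_comp_assoc, ← whiskerLeft_comp, t.inv_hom_id, whiskerLeft_id,
    whiskerLeft_id, Category.id_comp]

end Coherence

variable {C : Type u} [Category.{v} C] [MonoidalCategory C] {W W' : Type}

/-- Renaming the wires of a list. -/
def tensMap (A : W → C) (φ : W' → W) : ∀ l : List W',
    tens (fun w => A (φ w)) l ≅ tens A (l.map φ)
  | [] => Iso.refl (𝟙_ C)
  | w :: l => whiskerLeftIso (A (φ w)) (tensMap A φ l)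

/-- Renaming the wires of an event. -/
def homMap (A : W → C) (φ : W' → W) {l l' : List W'}
    (f : tens (fun w => A (φ w)) l ⟶ tens (fun w => A (φ w)) l') :
    tens A (l.map φ) ⟶ tens A (l'.map φ) :=
  (tensMap A φ l).inv ≫ f ≫ (tensMap A φ l').hom

variable {A : W → C} {φ : W' → W}

theorem homMap_comp {l₁ l₂ l₃ : List W'}
    (f : tens (fun w => A (φ w)) l₁ ⟶ tens (fun w => A (φ w)) l₂)
    (g : tens (fun w => A (φ w)) l₂ ⟶ tens (fun w => A (φ w)) l₃) :
    homMap A φ (f ≫ g) = homMap A φ f ≫ homMap A φ g := by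
  simp [homMap]

/-- Splitting a list of renamed wires. -/
def mapAppend (A : W → C) (φ : W' → W) (l₁ l₂ : List W') :
    tens A ((l₁ ++ l₂).map φ) ⟶ tens A (l₁.map φ ++ l₂.map φ) :=
  (tensMap A φ (l₁ ++ l₂)).inv ≫ (split (fun w => A (φ w)) l₁ l₂).hom ≫
    ((tensMap A φ l₁).hom ⊗ₘ (tensMap A φ l₂).hom) ≫ (split A (l₁.map φ) (l₂.map φ)).inv

theorem homMap_par {l₁ l₂ l₃ l₄ : List W'}
    (f : tens (fun w => A (φ w)) l₁ ⟶ tens (fun w => A (φ w)) l₂)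
    (g : tens (fun w => A (φ w)) l₃ ⟶ tens (fun w => A (φ w)) l₄) :
    homMap A φ (par _ f g) ≫ mapAppend A φ l₂ l₄ =
      mapAppend A φ l₁ l₃ ≫ par A (homMap A φ f) (homMap A φ g) := by
  simp [homMap, par, mapAppend]

variable [SymmetricCategory C]

theorem isPerm_mapAppend (l₁ l₂ : List W') : IsPerm A (mapAppend A φ l₁ l₂) := by
  induction l₁ with
  | nil => exact (IsPerm.id (A := A) (l₂.map φ)).of_eq (splitNil_map (tensMap A φ l₂))
  | cons w l ih =>
    exact (ih.cons (φ w)).of_eq (splitCons_map (A (φ w)) (tensMap A φ (l ++ l₂))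
      (split (fun w => A (φ w)) l l₂) (tensMap A φ l).hom (tensMap A φ l₂).hom
      (split A (l.map φ) (l₂.map φ)))

theorem IsPerm.map {l l' : List W'} {f : tens (fun w => A (φ w)) l ⟶ tens (fun w => A (φ w)) l'}
    (h : IsPerm (fun w => A (φ w)) f) : IsPerm A (homMap A φ f) := by
  induction h with
  | id l => exact (IsPerm.id (l.map φ)).of_eq (by simp [homMap])
  | comp _ _ h₁ h₂ => rw [homMap_comp]; exact h₁.comp h₂
  | @cons w l l' f _ h =>
    refine (h.cons (φ w)).of_eq (?_ : A (φ w) ◁ (tensMap A φ l).inv ≫ A (φ w) ◁ f ≫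
      A (φ w) ◁ (tensMap A φ l').hom = _)
    rw [← whiskerLeft_comp, ← whiskerLeft_comp, homMap]
  | swap w x l =>
    exact (IsPerm.swap (φ w) (φ x) (l.map φ)).of_eq
      (exch_conj (A (φ w)) (A (φ x)) (tensMap A φ l))

namespace Net

variable (A φ) in
/-- Renaming wires. -/
def map : Net (fun w => A (φ w)) →* Net A where
  toFun := Quotient.lift (fun f => Net.mk (homMap A φ f.hom)) (by
    rintro f g ⟨a, b, ha, hb, h⟩
    exact mk_eq_mk.2 ⟨_, _, ha.map, hb.map, by rw [← homMap_comp, h, homMap_comp]⟩)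
  map_one' := congrArg (Net.mk (l := []) (l' := [])) (by
    refine (Category.id_comp _).trans (Category.id_comp _))
  map_mul' x y := by
    induction x using ind with | _ f => ?_
    induction y using ind with | _ g => ?_
    exact mk_eq_mk.2 ⟨_, _, isPerm_mapAppend _ _, isPerm_mapAppend _ _, homMap_par f g⟩

theorem map_mk {l l' : List W'} (f : tens (fun w => A (φ w)) l ⟶ tens (fun w => A (φ w)) l') :
    map A φ (mk f) = mk (homMap A φ f) := rfl

theorem Comp.map {x y z : Net (fun w => A (φ w))} (h : Comp x y z) :
    Comp (Net.map A φ x) (Net.map A φ y) (Net.map A φ z) := by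
  cases h with | mk f g => ?_
  rw [map_mk, map_mk, map_mk, homMap_comp]
  exact .mk _ _

theorem map_scalar (s : 𝟙_ C ⟶ 𝟙_ C) : map A φ (scalar _ s) = scalar A s :=
  congrArg (Net.mk (l := []) (l' := [])) ((Category.id_comp _).trans (Category.comp_id _))

theorem map_state_comp {l : List W'} (σ : 𝟙_ C ⟶ tens A (l.map φ)) :
    map A φ (state (σ ≫ (tensMap A φ l).inv)) = state σ := by
  refine congrArg (Net.mk (l := [])) (?_ : 𝟙 _ ≫ (σ ≫ _) ≫ _ = σ)
  simp

theorem map_effect_comp {l : List W'} (a : tens A (l.map φ) ⟶ 𝟙_ C) :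
    map A φ (effect ((tensMap A φ l).hom ≫ a)) = effect a := by
  refine congrArg (Net.mk (l' := [])) (?_ : _ ≫ (_ ≫ a) ≫ 𝟙 _ = a)
  simp

theorem state_comp_isPerm {l l' : List W} (σ : 𝟙_ C ⟶ tens A l) {b : tens A l ⟶ tens A l'}
    (hb : IsPerm A b) : state (σ ≫ b) = state σ :=
  mk_comp_isPerm (l := []) σ hb

theorem Comp.mk_effect {l l' : List W} (f : tens A l ⟶ tens A l') (a : tens A l' ⟶ 𝟙_ C) :
    Comp (Net.mk f) (effect a) (effect (f ≫ a)) :=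
  .mk f _

variable {S P : Type}

theorem state_parStates (out : S → List W) (σ : ∀ s, 𝟙_ C ⟶ tens A (out s)) (l : List S) :
    state (parStates A out σ l) = (l.map fun s => state (σ s)).prod := by
  induction l with
  | nil => rfl
  | cons s l ih =>
    rw [List.map_cons, List.prod_cons, ← ih]
    rfl

theorem effect_parEffects (inp : P → List W) (a : ∀ j, tens A (inp j) ⟶ 𝟙_ C) (l : List P) :
    effect (parEffects A inp a l) = (l.map fun j => effect (a j)).prod := by
  induction l with
  | nil => rfl
  | cons j l ih =>
    rw [List.map_cons, List.prod_cons, ← ih]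
    rfl

/-- In `Net` the chosen listings of sources and parties, as well as `wiring`, disappear: only two
unordered products remain. -/
theorem comp_closedEvent [Fintype S] [Fintype P] [DecidableEq P] (inc : S → Finset P)
    (A : S × P → C) (σ : ∀ s, 𝟙_ C ⟶ tens A (outWires inc s))
    (a : ∀ j, tens A (inWires inc j) ⟶ 𝟙_ C) :
    Comp (∏ s, state (σ s)) (∏ j, effect (a j)) (scalar A (closedEvent inc A σ a)) := by
  rw [← Finset.prod_map_toList, ← Finset.prod_map_toList, ← state_parStates, ← effect_parEffects,
    ← state_comp_isPerm _ (wiring inc).isPerm]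
  refine Eq.subst (motive := Comp _ _) (congrArg (scalar A) ?_)
    (Comp.mk (l₁ := []) (l₃ := []) _ _)
  exact Category.assoc _ _ _

end Net

end Circuit

open Circuit

/-! ### Single-outcome tests and causality for nets. -/

namespace OperationalTheory

variable {C : Type u} [Category.{v} C] [MonoidalCategory C] [SymmetricCategory C]
  (T : OperationalTheory C) {W W' : Type} {A : W → C}

/-- The event `f` is a test with a single outcome. -/
def IsDet {X Y : C} (f : X ⟶ Y) : Prop := T.IsTest (fun _ : Unit => f)

variable {T}

theorem IsDet.comp {X Y Z : C} {f : X ⟶ Y} {g : Y ⟶ Z} (hf : T.IsDet f) (hg : T.IsDet g) :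
    T.IsDet (f ≫ g) :=
  T.isTest_relabel (Equiv.prodUnique Unit Unit).symm (T.isTest_comp hf hg)

theorem IsDet.tensor {X Y X' Y' : C} {f : X ⟶ Y} {g : X' ⟶ Y'} (hf : T.IsDet f)
    (hg : T.IsDet g) : T.IsDet (f ⊗ₘ g) :=
  T.isTest_relabel (Equiv.prodUnique Unit Unit).symm (T.isTest_tensor hf hg)

theorem IsDet.comp_isTest {X : Type} {A B D : C} {f : A ⟶ B} {g : X → (B ⟶ D)} (hf : T.IsDet f)
    (hg : T.IsTest g) : T.IsTest (fun x => f ≫ g x) :=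
  T.isTest_relabel (Equiv.uniqueProd X Unit).symm (T.isTest_comp hf hg)

variable (T) in
theorem isDet_id (X : C) : T.IsDet (𝟙 X) := T.isTest_id X

theorem IsDet.whiskerLeft (X : C) {Y Z : C} {f : Y ⟶ Z} (hf : T.IsDet f) : T.IsDet (X ◁ f) := by
  simpa using (T.isDet_id X).tensor hf

theorem IsDet.whiskerRight {Y Z : C} {f : Y ⟶ Z} (hf : T.IsDet f) (X : C) : T.IsDet (f ▷ X) := by
  simpa using hf.tensor (T.isDet_id X)

variable (T) in
theorem isDet_of_isPerm {l l' : List W} {f : tens A l ⟶ tens A l'} (h : IsPerm A f) :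
    T.IsDet f := by
  induction h with
  | id l => exact T.isDet_id _
  | comp _ _ h₁ h₂ => exact h₁.comp h₂
  | cons w _ h => exact h.whiskerLeft _
  | swap w x l =>
    exact IsDet.comp (T.isTest_associator_inv _ _ _)
      ((IsDet.whiskerRight (T.isTest_braiding _ _) _).comp (T.isTest_associator_hom _ _ _))

variable (T A) in
theorem isDet_split (l l' : List W) :
    T.IsDet (split A l l').hom ∧ T.IsDet (split A l l').inv := by
  induction l with
  | nil => exact ⟨T.isTest_leftUnitor_inv _, T.isTest_leftUnitor_hom _⟩
  | cons w l ih =>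
    exact ⟨(ih.1.whiskerLeft _).comp (T.isTest_associator_inv _ _ _),
      IsDet.comp (T.isTest_associator_hom _ _ _) (ih.2.whiskerLeft _)⟩

theorem IsDet.par {l₁ l₂ l₃ l₄ : List W} {f : tens A l₁ ⟶ tens A l₂} {g : tens A l₃ ⟶ tens A l₄}
    (hf : T.IsDet f) (hg : T.IsDet g) : T.IsDet (par A f g) :=
  (T.isDet_split A _ _).1.comp ((hf.tensor hg).comp (T.isDet_split A _ _).2)

variable (T A) in
theorem isDet_tensMap (φ : W' → W) (l : List W') :
    T.IsDet (tensMap A φ l).hom ∧ T.IsDet (tensMap A φ l).inv := by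
  induction l with
  | nil => exact ⟨T.isDet_id _, T.isDet_id _⟩
  | cons w l ih => exact ⟨ih.1.whiskerLeft _, ih.2.whiskerLeft _⟩

variable (T) in
/-- The class of a test with a single outcome. -/
inductive NetDet : Net A → Prop
  | mk {l l' : List W} {f : tens A l ⟶ tens A l'} : T.IsDet f → NetDet (Net.mk f)

/-- Determinism does not depend on the representative, because wire permutations are built from
structural tests. -/
theorem netDet_mk {l l' : List W} {f : tens A l ⟶ tens A l'} : T.NetDet (Net.mk f) ↔ T.IsDet f := by
  refine ⟨fun h => ?_, .mk⟩
  generalize hX : Net.mk f = X at h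
  cases h with | @mk _ _ g hg => ?_
  obtain ⟨a, b, ha, hb, e⟩ := Net.mk_eq_mk.1 hX
  obtain ⟨b', hb', e', -⟩ := hb.exists_inverse
  have : f = a ≫ g ≫ b' := by rw [← reassoc_of% e, e', Category.comp_id]
  rw [this]
  exact (T.isDet_of_isPerm ha).comp (hg.comp (T.isDet_of_isPerm hb'))

theorem netDet_state {l : List W} {σ : 𝟙_ C ⟶ tens A l} : T.NetDet (Net.state σ) ↔ T.IsDet σ :=
  netDet_mk (l := [])

theorem netDet_effect {l : List W} {a : tens A l ⟶ 𝟙_ C} : T.NetDet (Net.effect a) ↔ T.IsDet a :=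
  netDet_mk (l' := [])

theorem netDet_one : T.NetDet (1 : Net A) := .mk (T.isDet_id (𝟙_ C))

theorem netDet_ident (M : Multiset W) : T.NetDet (Net.ident A M) := .mk (T.isDet_id _)

theorem NetDet.mul {x y : Net A} (hx : T.NetDet x) (hy : T.NetDet y) : T.NetDet (x * y) := by
  cases hx with | mk hf => ?_
  cases hy with | mk hg => ?_
  exact .mk (hf.par hg)

theorem NetDet.prod {ι : Type*} (s : Finset ι) {x : ι → Net A} (h : ∀ i ∈ s, T.NetDet (x i)) :
    T.NetDet (∏ i ∈ s, x i) :=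
  Finset.prod_induction _ _ (fun _ _ => NetDet.mul) netDet_one h

theorem NetDet.comp {x y z : Net A} (h : Net.Comp x y z) (hx : T.NetDet x) (hy : T.NetDet y) :
    T.NetDet z := by
  cases h with | mk f g => exact .mk ((netDet_mk.1 hx).comp (netDet_mk.1 hy))

/-- In a causal theory, effects that are tests are determined by their inputs. -/
theorem IsCausal.effect_unique (hT : T.IsCausal) {x y : Net A} (hx : T.NetDet x) (hy : T.NetDet y)
    (hx₀ : x.cod = 0) (hy₀ : y.cod = 0) (h : x.dom = y.dom) : x = y := by
  generalize hl : x.dom.toList = l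
  have hx₁ : x.dom = (l : Multiset W) := by rw [← hl, Multiset.coe_toList]
  obtain ⟨f, rfl⟩ := x.exists_eq_effect hx₁ hx₀
  obtain ⟨g, rfl⟩ := y.exists_eq_effect h.symm hy₀
  exact congrArg _ ((hT _).unique (netDet_effect.1 hx) (netDet_effect.1 hy))

theorem IsCausal.exists_discard (hT : T.IsCausal) (M : Multiset W) :
    ∃ x : Net A, T.NetDet x ∧ x.dom = M ∧ x.cod = 0 := by
  obtain ⟨e, he, -⟩ := hT (tens A M.toList)
  exact ⟨Net.effect e, netDet_effect.2 he, Multiset.coe_toList M, rfl⟩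

/-- Causality for the trivial system, whose discarding test is the identity. -/
theorem IsCausal.scalar_eq_one (hT : T.IsCausal) {x : Net A} (hx : T.NetDet x) (h : x.dom = 0)
    (h' : x.cod = 0) : x = 1 :=
  hT.effect_unique hx netDet_one h' rfl h

end OperationalTheory

/-! ### Summing over outcomes. -/

namespace Circuit

section Coherence

variable {C : Type u} [Category.{v} C] [MonoidalCategory C]

theorem effect_tensor_head {X Y E : C} (b : X ⟶ 𝟙_ C) (t : Y ⟶ X ⊗ E) (r : E ⟶ 𝟙_ C) :
    t ≫ (b ⊗ₘ r) ≫ (λ_ (𝟙_ C)).hom = t ≫ (b ▷ E) ≫ (𝟙_ C ◁ r ≫ (λ_ (𝟙_ C)).hom) := by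
  rw [MonoidalCategory.tensorHom_def, Category.assoc]

theorem effect_tensor_tail {X Y K L E : C} (t : Y ⟶ K ⊗ L) (c : K ⟶ 𝟙_ C) (ρ : L ⟶ X ⊗ E)
    (b : X ⟶ 𝟙_ C) (ε : 𝟙_ C ⊗ E ⟶ 𝟙_ C) :
    t ≫ (c ⊗ₘ (ρ ≫ b ▷ E ≫ ε)) ≫ (λ_ (𝟙_ C)).hom =
      (t ≫ c ▷ L ≫ (λ_ L).hom ≫ ρ) ≫ b ▷ E ≫ ε := by
  simp [MonoidalCategory.tensorHom_def]

end Coherence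

variable {C : Type u} [Category.{v} C] [MonoidalCategory C] {W P : Type}

theorem parEffects_congr {A : W → C} {inp : P → List W} {a a' : ∀ j, tens A (inp j) ⟶ 𝟙_ C}
    {l : List P} (h : ∀ j ∈ l, a j = a' j) : parEffects A inp a l = parEffects A inp a' l := by
  induction l with
  | nil => rfl
  | cons j l ih =>
    simp only [parEffects]
    rw [h j List.mem_cons_self, ih fun k hk => h k (List.mem_cons_of_mem _ hk)]

variable [DecidableEq P]

/-- A parallel composition of effects, as a circuit around one of them. -/
theorem parEffects_update (A : W → C) (inp : P → List W) (a : ∀ j, tens A (inp j) ⟶ 𝟙_ C) (k : P)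
    {l : List P} (hl : l.Nodup) (hk : k ∈ l) :
    ∃ (E : C) (ρ : tens A (l.flatMap inp) ⟶ tens A (inp k) ⊗ E) (ε : 𝟙_ C ⊗ E ⟶ 𝟙_ C),
      ∀ b, parEffects A inp (Function.update a k b) l = ρ ≫ (b ▷ E) ≫ ε := by
  induction l with
  | nil => exact absurd hk List.not_mem_nil
  | cons j l ih =>
    obtain ⟨hj, hl⟩ := List.nodup_cons.1 hl
    by_cases h : j = k
    · subst h
      refine ⟨_, (split A (inp j) (l.flatMap inp)).hom,
        𝟙_ C ◁ parEffects A inp a l ≫ (λ_ (𝟙_ C)).hom, fun b => ?_⟩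
      have e : parEffects A inp (Function.update a j b) l = parEffects A inp a l :=
        parEffects_congr fun x hx => Function.update_of_ne (by rintro rfl; exact hj hx) _ _
      simp only [parEffects]
      rw [e, Function.update_self]
      exact effect_tensor_head b _ _
    · obtain ⟨E, ρ, ε, hE⟩ := ih hl ((List.mem_cons.1 hk).resolve_left (Ne.symm h))
      refine ⟨E, (split A (inp j) (l.flatMap inp)).hom ≫ a j ▷ _ ≫ (λ_ _).hom ≫ ρ, ε,
        fun b => ?_⟩
      simp only [parEffects]
      rw [hE, Function.update_of_ne h]
      exact effect_tensor_tail _ _ _ _ _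

end Circuit

namespace OperationalTheory

variable {C : Type u} [Category.{v} C] [MonoidalCategory C] [SymmetricCategory C]
  {T : OperationalTheory C} {S P : Type} [Fintype S] [Fintype P] [DecidableEq P]

/-- Summing over the outcomes of one measurement amounts to discarding its inputs. -/
theorem IsCausal.sum_prob_closedEvent (hT : T.IsCausal) (inc : S → Finset P) (A : S × P → C)
    (σ : ∀ s, 𝟙_ C ⟶ tens A (outWires inc s)) (a : ∀ j, tens A (inWires inc j) ⟶ 𝟙_ C) (k : P)
    {X : Type} [Fintype X] [Nonempty X] {M : X → (tens A (inWires inc k) ⟶ 𝟙_ C)}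
    (hM : T.IsTest M) {d : tens A (inWires inc k) ⟶ 𝟙_ C} (hd : T.IsDet d) :
    ∑ x, T.prob (closedEvent inc A σ (Function.update a k (M x))) =
      T.prob (closedEvent inc A σ (Function.update a k d)) := by
  obtain ⟨E, ρ, ε, h⟩ := parEffects_update A (inWires inc) a k (Finset.nodup_toList Finset.univ)
    (Finset.mem_toList.2 (Finset.mem_univ k))
  -- Merging all outcomes gives a one-outcome test, hence the discarding test. Merging must be
  -- surjective, which is where a nonempty outcome set enters.
  obtain ⟨g, hg, hg'⟩ := T.coarseGrain hM (fun _ => ()) (fun _ => ⟨Classical.arbitrary X, rfl⟩)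
  have e : g () = d := (hT _).unique hg hd
  have key := hg' () E (parStates A (outWires inc) σ Finset.univ.toList ≫ (wiring inc).hom A ≫ ρ) ε
  rw [e, Finset.filter_true_of_mem (fun _ _ => rfl)] at key
  simp only [closedEvent, h]
  simpa only [Category.assoc] using key.symm

end OperationalTheory

/-- Summing a function over families of outcomes that are prescribed outside of `K`, if summing over
one outcome amounts to inserting `d`. -/
theorem sum_filter_eq_of_sum_update {P : Type} [DecidableEq P] [Fintype P] {V : P → Type}
    [∀ j, Fintype (V j)] [∀ j, DecidableEq (V j)] {E : P → Type*} (M : ∀ j, V j → E j)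
    (d : ∀ j, E j) (F : (∀ j, E j) → ℝ)
    (h : ∀ k a, ∑ x, F (Function.update a k (M k x)) = F (Function.update a k (d k)))
    (K : Finset P) (u : ∀ j, V j) :
    ∑ v : ∀ j, V j with ∀ j ∉ K, v j = u j, F (fun j => M j (v j)) =
      F (fun j => if j ∈ K then d j else M j (u j)) := by
  induction K using Finset.induction_on generalizing u with
  | empty =>
    have : (Finset.univ.filter fun v : ∀ j, V j => ∀ j ∉ (∅ : Finset P), v j = u j) = {u} := by
      ext v
      simp [funext_iff]
    rw [this, Finset.sum_singleton]
    simp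
  | insert k K hk ih =>
    -- With `v k = x` fixed, the inner sum prescribes the outcomes outside `K` by the updated `u`,
    -- so the induction hypothesis evaluates it; summing over `x` then inserts `d k`.
    rw [← Finset.sum_fiberwise _ (fun v => v k)]
    have e : ∀ x, (Finset.univ.filter fun v : ∀ j, V j => ∀ j ∉ insert k K, v j = u j).filter
        (fun v => v k = x) =
        Finset.univ.filter fun v : ∀ j, V j => ∀ j ∉ K, v j = Function.update u k x j := by
      intro x
      ext v
      simp only [Finset.mem_filter, Finset.mem_univ, true_and, Finset.mem_insert, not_or]
      constructor
      · rintro ⟨h₁, h₂⟩ j hj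
        by_cases hjk : j = k
        · subst hjk; simpa using h₂
        · rw [Function.update_of_ne hjk]; exact h₁ j ⟨hjk, hj⟩
      · refine fun h₁ => ⟨fun j hj => ?_, ?_⟩
        · rw [h₁ j hj.2, Function.update_of_ne hj.1]
        · simpa using h₁ k hk
    have e' : ∀ x, (fun j => if j ∈ K then d j else M j (Function.update u k x j)) =
        Function.update (fun j => if j ∈ insert k K then d j else M j (u j)) k (M k x) := by
      intro x
      ext j
      by_cases hjk : j = k
      · subst hjk; simp [hk]
      · simp [hjk]
    simp only [e, ih, e', h]
    congr 1
    ext j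
    by_cases hjk : j = k
    · subst hjk; simp
    · simp [hjk]

/-! ### Breaking the sources that do not involve `i`. -/

namespace Circuit

variable {S P : Type}

theorem coe_outWires (inc : S → Finset P) (s : S) :
    (outWires inc s : Multiset (S × P)) = ∑ k ∈ inc s, {(s, k)} := by
  rw [outWires, ← Multiset.map_coe, Finset.coe_toList, Finset.sum,
    ← Multiset.sum_map_singleton (Multiset.map _ _), Multiset.map_map]
  rfl

theorem coe_inWires [Fintype S] [DecidableEq P] (inc : S → Finset P) (j : P) :
    (inWires inc j : Multiset (S × P)) = ∑ s with j ∈ inc s, {(s, j)} := by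
  rw [inWires, ← Multiset.map_coe, Finset.coe_toList, Finset.sum,
    ← Multiset.sum_map_singleton (Multiset.map _ _), Multiset.map_map]
  rfl

namespace Net

variable {C : Type u} [Category.{v} C] [MonoidalCategory C] [SymmetricCategory C] {W : Type}
  {A : W → C}

/-- States that agree after an effect `e` may be exchanged in front of `e`. -/
theorem Comp.replace_state {x x' y z e f s : Net A} {M : Multiset W} (he : e.cod = 0)
    (hn : (x * y).cod.Nodup) (h : Comp x (e * ident A M) z) (h' : Comp x' (e * ident A M) z)
    (hs : Comp (x * y) (e * f) s) : Comp (x' * y) (e * f) s := by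
  -- Cancelling the inputs of `e` from the matching condition of `hs` leaves that of `z * y` with
  -- `f`.
  have hz : (z * y).cod = f.dom := by
    have h₁ := hs.mid_eq
    rw [cod_mul, h.mid_eq, dom_mul, dom_mul, dom_ident, add_assoc, add_right_inj] at h₁
    rw [cod_mul, h.cod_eq, cod_mul, he, zero_add, cod_ident, h₁]
  obtain ⟨s', hs'⟩ := Comp.exists hz
  rw [hs.unique hn (h.slide_effect he hn hs')]
  refine h'.slide_effect he ?_ hs'
  rwa [cod_mul, h'.mid_eq, ← h.mid_eq, ← cod_mul]

theorem nodup_cod_states [Fintype S] (inc : S → Finset P) (A : S × P → C)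
    (σ : ∀ s, 𝟙_ C ⟶ tens A (outWires inc s)) : (∏ s, state (σ s)).cod.Nodup := by
  rw [← Finset.prod_map_toList, ← state_parStates]
  exact nodup_out inc

end Net

end Circuit

namespace OperationalTheory

open Net

variable {C : Type u} [Category.{v} C] [MonoidalCategory C] [SymmetricCategory C]
  {T : OperationalTheory C} {S P : Type}

variable (T) in
/-- A choice of discarding tests for all wires. -/
def IsDiscard {W : Type} {A : W → C} (disc : W → Net A) : Prop :=
  ∀ w, T.NetDet (disc w) ∧ (disc w).dom = {w} ∧ (disc w).cod = 0

theorem IsDiscard.prod_det {W : Type} {A : W → C} {disc : W → Net A} (hd : T.IsDiscard disc)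
    {ι : Type*} (s : Finset ι) (f : ι → W) :
    T.NetDet (∏ i ∈ s, disc (f i)) ∧ (∏ i ∈ s, disc (f i)).dom = ∑ i ∈ s, {f i} ∧
      (∏ i ∈ s, disc (f i)).cod = 0 :=
  ⟨NetDet.prod _ fun _ _ => (hd _).1, by simp [(hd _).2.1], by simp [(hd _).2.2]⟩

variable [DecidableEq P]

/-- `μ` consists of the one-wire marginals of the states `σ`. -/
def IsMarginal {inc : S → Finset P} {A : S × P → C} (disc μ : S × P → Net A)
    (σ : ∀ s, 𝟙_ C ⟶ tens A (outWires inc s)) : Prop :=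
  ∀ s, ∀ k ∈ inc s, Comp (Net.state (σ s))
    ((∏ k' ∈ (inc s).erase k, disc (s, k')) * ident A {(s, k)}) (μ (s, k))

variable {inc : S → Finset P} {A : S × P → C} {disc μ : S × P → Net A}
  {σ σ' : ∀ s, 𝟙_ C ⟶ tens A (outWires inc s)}

theorem IsDiscard.exists_marginal (hd : T.IsDiscard disc)
    (σ : ∀ s, 𝟙_ C ⟶ tens A (outWires inc s)) : ∃ μ : S × P → Net A, IsMarginal disc μ σ := by
  have h : ∀ w : S × P, ∃ m : Net A, w.2 ∈ inc w.1 → Comp (Net.state (σ w.1))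
      ((∏ k' ∈ (inc w.1).erase w.2, disc (w.1, k')) * ident A {w}) m := by
    rintro ⟨s, k⟩
    by_cases hk : k ∈ inc s
    · have h := Net.Comp.exists (x := Net.state (σ s))
        (y := (∏ k' ∈ (inc s).erase k, disc (s, k')) * ident A {(s, k)}) (by
          rw [cod_state, dom_mul, dom_ident, (hd.prod_det _ _).2.1, coe_outWires,
            Finset.sum_erase_add _ _ hk])
      exact h.imp fun _ h _ => h
    · exact ⟨1, fun h => absurd h hk⟩
  choose μ hμ using h
  exact ⟨μ, fun s k hk => hμ (s, k) hk⟩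

theorem IsMarginal.det (hm : IsMarginal disc μ σ) (hd : T.IsDiscard disc)
    (hσ : ∀ s, T.IsDet (σ s)) {s : S} {k : P} (hk : k ∈ inc s) :
    T.NetDet (μ (s, k)) ∧ (μ (s, k)).dom = 0 ∧ (μ (s, k)).cod = {(s, k)} := by
  have h := hm s k hk
  refine ⟨.comp h (netDet_state.2 (hσ s)) ((hd.prod_det _ _).1.mul (netDet_ident _)), h.dom_eq, ?_⟩
  rw [h.cod_eq, cod_mul, (hd.prod_det _ _).2.2, cod_ident, zero_add]

/-- The states `σ'` that differ from `σ` by breaking those at which `i` is not involved into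
one-wire marginals. -/
theorem IsMarginal.exists_broken (hm : IsMarginal disc μ σ) (hd : T.IsDiscard disc)
    (hσ : ∀ s, T.IsDet (σ s)) (i : P) :
    ∃ σ' : ∀ s, 𝟙_ C ⟶ tens A (outWires inc s), (∀ s, T.IsDet (σ' s)) ∧
      (∀ s, i ∈ inc s → σ' s = σ s) ∧
      ∀ s, i ∉ inc s → Net.state (σ' s) = ∏ k ∈ inc s, μ (s, k) := by
  have h : ∀ s, ∃ τ : 𝟙_ C ⟶ tens A (outWires inc s), T.IsDet τ ∧
      (i ∈ inc s → τ = σ s) ∧ (i ∉ inc s → Net.state τ = ∏ k ∈ inc s, μ (s, k)) := by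
    intro s
    by_cases hi : i ∈ inc s
    · exact ⟨σ s, hσ s, fun _ => rfl, fun h => absurd hi h⟩
    · obtain ⟨f, hf⟩ := (∏ k ∈ inc s, μ (s, k)).exists_eq_state (l := outWires inc s)
        (by rw [dom_prod, Finset.sum_congr rfl fun k hk => (hm.det hd hσ hk).2.1]; simp)
        (by rw [cod_prod, Finset.sum_congr rfl fun k hk => (hm.det hd hσ hk).2.2, coe_outWires])
      refine ⟨f, ?_, fun h => absurd h hi, fun _ => hf⟩
      rw [← netDet_state, hf]
      exact .prod _ fun k hk => (hm.det hd hσ hk).1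
  choose σ' h₁ h₂ h₃ using h
  exact ⟨σ', h₁, h₂, h₃⟩

/-- The effect on the outputs of `s` that discards all wires but the one to `j`. -/
noncomputable def keepOnly (disc : S × P → Net A) (inc : S → Finset P) (j : P) (s : S) : Net A :=
  (∏ k ∈ (inc s).erase j, disc (s, k)) * ident A (if j ∈ inc s then {(s, j)} else 0)

/-- The form with one factor per wire, which can be composed factorwise with a product of marginals.
-/
theorem keepOnly_eq_prod (j : P) (s : S) : keepOnly disc inc j s =
    ∏ k ∈ inc s, if k = j then ident A {(s, j)} else disc (s, k) := by
  by_cases hj : j ∈ inc s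
  · rw [keepOnly, if_pos hj, ← Finset.prod_erase_mul _ _ hj, if_pos rfl]
    congr 1
    exact Finset.prod_congr rfl fun k hk => (if_neg (Finset.ne_of_mem_erase hk)).symm
  · rw [keepOnly, if_neg hj, ident_zero, mul_one, Finset.erase_eq_of_notMem hj]
    exact Finset.prod_congr rfl fun k hk => (if_neg (by rintro rfl; exact hj hk)).symm

/-- If `j` receives a wire this is the defining property of the marginal. Otherwise the whole
deterministic state is discarded, leaving a deterministic closed event, which is `1`. -/
theorem IsMarginal.comp_keepOnly (hm : IsMarginal disc μ σ) (hT : T.IsCausal)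
    (hd : T.IsDiscard disc) (hσ : ∀ s, T.IsDet (σ s)) (j : P) (s : S) :
    Comp (Net.state (σ s)) (keepOnly disc inc j s) (if j ∈ inc s then μ (s, j) else 1) := by
  by_cases hj : j ∈ inc s
  · rw [if_pos hj, keepOnly, if_pos hj]
    exact hm s j hj
  · rw [if_neg hj, keepOnly, if_neg hj, ident_zero, mul_one, Finset.erase_eq_of_notMem hj]
    obtain ⟨h₁, h₂, h₃⟩ := hd.prod_det (inc s) (fun k => (s, k))
    obtain ⟨z, hz⟩ := Net.Comp.exists (x := Net.state (σ s))
      (y := ∏ k ∈ inc s, disc (s, k)) (by rw [h₂, cod_state, coe_outWires])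
    have : z = 1 := hT.scalar_eq_one (.comp hz (netDet_state.2 (hσ s)) h₁) hz.dom_eq
      (hz.cod_eq.trans h₃)
    exact this ▸ hz

/-- The result agrees with that of the unbroken source, so no single `j` can tell the two apart.
Every factor other than the one at `j` is discarded to `1`. -/
theorem IsMarginal.comp_keepOnly_prod (hm : IsMarginal disc μ σ) (hT : T.IsCausal)
    (hd : T.IsDiscard disc) (hσ : ∀ s, T.IsDet (σ s)) (j : P) (s : S) :
    Comp (∏ k ∈ inc s, μ (s, k)) (keepOnly disc inc j s)
      (if j ∈ inc s then μ (s, j) else 1) := by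
  rw [keepOnly_eq_prod, ← Finset.prod_ite_eq' (inc s) j (fun k => μ (s, k))]
  refine Comp.prod _ fun k hk => ?_
  obtain ⟨h₁, h₂, h₃⟩ := hm.det hd hσ hk
  by_cases hkj : k = j
  · subst hkj
    rw [if_pos rfl, if_pos rfl, ← h₃]
    exact .ident_right _
  · rw [if_neg hkj, if_neg hkj]
    obtain ⟨z, hz⟩ := Net.Comp.exists (h₃.trans (hd (s, k)).2.1.symm)
    have : z = 1 := hT.scalar_eq_one (.comp hz h₁ (hd _).1) (hz.dom_eq.trans h₂)
      (hz.cod_eq.trans (hd _).2.2)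
    exact this ▸ hz

variable [Fintype S]

/-- Discarding wire by wire is also a one-outcome effect on the same inputs, so uniqueness
identifies the two. -/
theorem IsDiscard.eq_prod (hT : T.IsCausal) (hd : T.IsDiscard disc) {j : P}
    {a : tens A (inWires inc j) ⟶ 𝟙_ C} (ha : T.IsDet a) :
    Net.effect a = ∏ s with j ∈ inc s, disc (s, j) := by
  obtain ⟨h₁, h₂, h₃⟩ := hd.prod_det (Finset.univ.filter fun s => j ∈ inc s) (fun s => (s, j))
  refine hT.effect_unique (netDet_effect.2 ha) h₁ rfl h₃ ?_
  rw [h₂, dom_effect, coe_inWires]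

variable [Fintype P]

/-- Breaking the states that do not involve `i` is not noticed by `i` and another party. -/
theorem IsMarginal.closedEvent_broken (hm : IsMarginal disc μ σ) (hT : T.IsCausal)
    (hd : T.IsDiscard disc) (hσ : ∀ s, T.IsDet (σ s)) {i j : P} (hij : j ≠ i)
    (hσ₁ : ∀ s, i ∈ inc s → σ' s = σ s)
    (hσ₂ : ∀ s, i ∉ inc s → Net.state (σ' s) = ∏ k ∈ inc s, μ (s, k))
    (a : ∀ k, tens A (inWires inc k) ⟶ 𝟙_ C) (ha : ∀ k, k ≠ i → k ≠ j → T.IsDet (a k)) :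
    closedEvent inc A σ a = closedEvent inc A σ' a := by
  -- The discarded wires of each source, namely those leading to neither `i` nor `j`.
  set D : S → Net A := fun s => ∏ k ∈ ((inc s).erase j).erase i, disc (s, k) with hD
  have hDcod : ∀ s, (D s).cod = 0 := fun s => (hd.prod_det _ _).2.2
  -- The discards, originally grouped by receiving party, are regrouped by source, and the sources
  -- not involving `i` are separated.
  have heff : ∏ k, Net.effect (a k) = (∏ s with i ∉ inc s, D s) *
      ((∏ s with ¬ i ∉ inc s, D s) * (Net.effect (a j) * Net.effect (a i))) := by
    rw [← mul_assoc, Finset.prod_filter_mul_prod_filter_not,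
      ← Finset.prod_erase_mul Finset.univ _ (Finset.mem_univ j),
      ← Finset.prod_erase_mul (Finset.univ.erase j) _
        (Finset.mem_erase.2 ⟨hij.symm, Finset.mem_univ i⟩),
      Finset.prod_congr rfl fun k hk => hd.eq_prod hT (ha k (Finset.ne_of_mem_erase hk)
        (Finset.ne_of_mem_erase (Finset.mem_of_mem_erase hk))), mul_assoc,
      mul_comm (Net.effect (a i))]
    congr 1
    exact Finset.prod_comm' (by simp [and_assoc, and_comm])
  have hst : ∀ τ : ∀ s, 𝟙_ C ⟶ tens A (outWires inc s), ∏ s, Net.state (τ s) =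
      (∏ s with i ∉ inc s, Net.state (τ s)) *
        ∏ s with ¬ i ∉ inc s, Net.state (τ s) := fun τ =>
    (Finset.prod_filter_mul_prod_filter_not _ _ _).symm
  have hkeep : ∏ s with i ∉ inc s, keepOnly disc inc j s = (∏ s with i ∉ inc s, D s) *
      ident A (∑ s with i ∉ inc s, if j ∈ inc s then {(s, j)} else 0) := by
    rw [ident_sum, ← Finset.prod_mul_distrib]
    refine Finset.prod_congr rfl fun s hs => ?_
    simp only [keepOnly, hD]
    rw [Finset.erase_eq_of_notMem (s := (inc s).erase j)]
    exact fun h => (Finset.mem_filter.1 hs).2 (Finset.mem_of_mem_erase h)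
  have h₁ := Comp.prod (Finset.univ.filter fun s => i ∉ inc s) fun s _ =>
    hm.comp_keepOnly hT hd hσ j s
  have h₂ := Comp.prod (Finset.univ.filter fun s => i ∉ inc s) fun s _ =>
    hm.comp_keepOnly_prod hT hd hσ j s
  rw [hkeep] at h₁ h₂
  have hc := comp_closedEvent inc A σ a
  have hc' := comp_closedEvent inc A σ' a
  have hn := nodup_cod_states inc A σ
  have hn' := nodup_cod_states inc A σ'
  rw [hst, heff] at hc hc'
  rw [hst] at hn hn'
  -- After the discards, the original and broken sources leave the same state, so one family may
  -- replace the other.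
  have key := h₁.replace_state (by simp [hDcod]) hn h₂ hc
  rw [Finset.prod_congr rfl fun s hs => (hσ₂ s (Finset.mem_filter.1 hs).2).symm,
    Finset.prod_congr (s₁ := Finset.univ.filter fun s => ¬ i ∉ inc s) rfl fun s hs => congrArg _
      (hσ₁ s (not_not.1 (Finset.mem_filter.1 hs).2)).symm] at key
  exact scalar_injective (key.unique hn' hc')

end OperationalTheory

/-! ### Removing the party `i`. -/

namespace OperationalTheory

open Net

variable {C : Type u} [Category.{v} C] [MonoidalCategory C] [SymmetricCategory C]
  {T : OperationalTheory C} {S P : Type} {inc : S → Finset P} {A : S × P → C}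
  {disc μ : S × P → Net A} {σ σ' : ∀ s, 𝟙_ C ⟶ tens A (outWires inc s)} {i : P}
  {S' : Type} {inc' : S' → Finset {k // k ≠ i}} {e : S' ↪ S}

/-- The wires of the network without the party `i`, as wires of the original network. -/
def wireMap (e : S' → S) (i : P) (w : S' × {k // k ≠ i}) : S × P := (e w.1, w.2)

theorem coe_outWires_map (s : S') (e : S' → S) :
    ((outWires inc' s).map (wireMap e i) : Multiset (S × P)) = ∑ k ∈ inc' s, {(e s, k.1)} := by
  rw [← Multiset.map_coe, coe_outWires]
  exact map_sum (Multiset.mapAddMonoidHom (wireMap e i)) _ _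

variable [DecidableEq P]

theorem coe_inWires_map [Fintype S'] (k : {k // k ≠ i}) (e : S' → S) :
    ((inWires inc' k).map (wireMap e i) : Multiset (S × P)) =
      ∑ s with k ∈ inc' s, {(e s, k.1)} := by
  rw [← Multiset.map_coe, coe_inWires]
  exact map_sum (Multiset.mapAddMonoidHom (wireMap e i)) _ _

/-- The states of the network without the party `i`: the wires to `i` are discarded. -/
theorem IsDiscard.exists_reduced_state (hd : T.IsDiscard disc) (hσ : ∀ s, T.IsDet (σ s))
    (hinc : ∀ s, inc (e s) = insert i ((inc' s).map (Function.Embedding.subtype _))) (s : S') :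
    ∃ τ : 𝟙_ C ⟶ tens A ((outWires inc' s).map (wireMap e i)), T.IsDet τ ∧
      Comp (state (σ (e s))) (disc (e s, i) *
        ident A ((outWires inc' s).map (wireMap e i) : List (S × P))) (state τ) := by
  obtain ⟨h₁, h₂, h₃⟩ := hd (e s, i)
  obtain ⟨x, hx⟩ := Net.Comp.exists (x := state (σ (e s))) (y := disc (e s, i) *
      ident A ((outWires inc' s).map (wireMap e i) : List (S × P))) (by
    rw [cod_state, dom_mul, dom_ident, h₂, coe_outWires_map, coe_outWires, hinc,
      Finset.sum_insert (by simp), Finset.sum_map]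
    rfl)
  obtain ⟨τ, rfl⟩ := x.exists_eq_state (l := (outWires inc' s).map (wireMap e i)) hx.dom_eq
    (by rw [hx.cod_eq, cod_mul, h₃, zero_add, cod_ident])
  exact ⟨τ, netDet_state.1 (.comp hx (netDet_state.2 (hσ _)) (h₁.mul (netDet_ident _))), hx⟩

variable [Fintype S] [Fintype S']

/-- Together, `he` and `hinc` say that `e` identifies the sources of the reduced network with the
sources involving `i`. -/
theorem filter_mem_eq_map (he : ∀ s, i ∈ inc s → s ∈ Set.range e)
    (hinc : ∀ s, inc (e s) = insert i ((inc' s).map (Function.Embedding.subtype _))) :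
    (Finset.univ.filter fun s => i ∈ inc s) = Finset.univ.map e := by
  ext s
  simp only [Finset.mem_filter, Finset.mem_univ, true_and, Finset.mem_map]
  refine ⟨he s, ?_⟩
  rintro ⟨s', rfl⟩
  rw [hinc]
  exact Finset.mem_insert_self _ _

theorem filter_mem_mem_eq_map (he : ∀ s, i ∈ inc s → s ∈ Set.range e)
    (hinc : ∀ s, inc (e s) = insert i ((inc' s).map (Function.Embedding.subtype _)))
    (k : {k // k ≠ i}) : (Finset.univ.filter fun s => k.1 ∈ inc s ∧ ¬ i ∉ inc s) =
      (Finset.univ.filter fun s => k ∈ inc' s).map e := by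
  ext s
  simp only [Finset.mem_filter, Finset.mem_univ, true_and, Finset.mem_map, not_not]
  constructor
  · rintro ⟨h₁, h₂⟩
    obtain ⟨s', rfl⟩ := he s h₂
    rw [hinc, Finset.mem_insert] at h₁
    exact ⟨s', by simpa [k.2] using h₁, rfl⟩
  · rintro ⟨s', h, rfl⟩
    rw [hinc]
    exact ⟨by simp [h, k.2], Finset.mem_insert_self _ _⟩

/-- The local marginals that are absorbed into the measurement of `k`. -/
theorem IsMarginal.exists_absorbed (hm : IsMarginal disc μ σ) (hd : T.IsDiscard disc)
    (hσ : ∀ s, T.IsDet (σ s)) (he : ∀ s, i ∈ inc s → s ∈ Set.range e)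
    (hinc : ∀ s, inc (e s) = insert i ((inc' s).map (Function.Embedding.subtype _)))
    (k : {k // k ≠ i}) :
    ∃ h : tens A ((inWires inc' k).map (wireMap e i)) ⟶ tens A (inWires inc k.1), T.IsDet h ∧
      Net.mk h = (∏ s with k.1 ∈ inc s ∧ i ∉ inc s, μ (s, k.1)) *
        ident A ((inWires inc' k).map (wireMap e i) : List (S × P)) := by
  have hμ : ∀ s ∈ Finset.univ.filter (fun s => k.1 ∈ inc s ∧ i ∉ inc s), _ := fun s hs =>
    hm.det hd hσ (Finset.mem_filter.1 hs).2.1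
  obtain ⟨f, hf⟩ := ((∏ s with k.1 ∈ inc s ∧ i ∉ inc s, μ (s, k.1)) *
      ident A ((inWires inc' k).map (wireMap e i) : List (S × P))).exists_eq_mk
    (l := (inWires inc' k).map (wireMap e i)) (l' := inWires inc k.1)
    (by rw [dom_mul, dom_prod, Finset.sum_congr rfl fun s hs => (hμ s hs).2.1]; simp)
    (by
      -- The inputs of `k` come either from broken sources, which supply marginals, or from sources
      -- involving `i`, whose wires survive in the reduced network.
      rw [cod_mul, cod_prod, Finset.sum_congr rfl fun s hs => (hμ s hs).2.2, cod_ident,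
        coe_inWires_map, coe_inWires,
        ← Finset.sum_filter_add_sum_filter_not (Finset.univ.filter fun s => k.1 ∈ inc s)
          (fun s => i ∉ inc s), Finset.filter_filter,
        Finset.filter_filter, filter_mem_mem_eq_map he hinc, Finset.sum_map])
  refine ⟨f, ?_, hf⟩
  rw [← netDet_mk, hf]
  exact (NetDet.prod _ fun s hs => (hμ s hs).1).mul (netDet_ident _)

variable [Fintype P]

/-- If the party `i` discards its inputs and the states at which it is not involved are broken,
then the network reduces to a network of the other parties. -/
theorem IsMarginal.exists_reduced (hm : IsMarginal disc μ σ) (hT : T.IsCausal)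
    (hd : T.IsDiscard disc) (hσ : ∀ s, T.IsDet (σ s))
    (hσ₁ : ∀ s, i ∈ inc s → σ' s = σ s)
    (hσ₂ : ∀ s, i ∉ inc s → state (σ' s) = ∏ k ∈ inc s, μ (s, k))
    (he : ∀ s, i ∈ inc s → s ∈ Set.range e)
    (hinc : ∀ s, inc (e s) = insert i ((inc' s).map (Function.Embedding.subtype _))) :
    ∃ (σ'' : ∀ s, 𝟙_ C ⟶ tens (fun w => A (wireMap e i w)) (outWires inc' s))
      (g : ∀ k, tens (fun w => A (wireMap e i w)) (inWires inc' k) ⟶ tens A (inWires inc k.1)),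
      (∀ s, T.IsDet (σ'' s)) ∧ (∀ k, T.IsDet (g k)) ∧
      ∀ a : ∀ k, tens A (inWires inc k) ⟶ 𝟙_ C, T.IsDet (a i) →
        closedEvent inc' _ σ'' (fun k => g k ≫ a k.1) = closedEvent inc A σ' a := by
  choose τ hτ hτ' using hd.exists_reduced_state hσ hinc
  choose h hh hh' using hm.exists_absorbed hd hσ he hinc
  refine ⟨fun s => τ s ≫ (tensMap A (wireMap e i) _).inv,
    fun k => (tensMap A (wireMap e i) _).hom ≫ h k, fun s => (hτ s).comp (T.isDet_tensMap A _ _).2,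
    fun k => IsDet.comp (T.isDet_tensMap A _ _).1 (hh k), fun a ha => ?_⟩
  -- The reduced network is renamed into the original wires, so that both closed events live in the
  -- same `Net A`.
  have hc := (comp_closedEvent inc' _ (fun s => τ s ≫ (tensMap A (wireMap e i) _).inv)
    (fun k => ((tensMap A (wireMap e i) _).hom ≫ h k) ≫ a k.1)).map
  simp only [map_prod, map_scalar, map_state_comp, Category.assoc, map_effect_comp] at hc
  simp only [Category.assoc]
  set s₀ := closedEvent inc' (fun w => A (wireMap e i w))
    (fun s => τ s ≫ (tensMap A (wireMap e i) _).inv)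
    (fun k => (tensMap A (wireMap e i) _).hom ≫ h k ≫ a k.1) with hs₀
  -- All marginals of broken sources, grouped by receiving party. There is no factor for `i`, since
  -- these sources do not involve it.
  set Y : Net A := ∏ k : {k // k ≠ i}, ∏ s with k.1 ∈ inc s ∧ i ∉ inc s, μ (s, k.1) with hY
  have hYdom : Y.dom = 0 := by
    simp only [hY, dom_prod]
    refine Finset.sum_eq_zero fun k _ => Finset.sum_eq_zero fun s hs => ?_
    exact (hm.det hd hσ (Finset.mem_filter.1 hs).2.1).2.1
  have hstates : ∏ s, state (σ' s) = (∏ s, state (σ (e s))) * Y := by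
    rw [← Finset.prod_filter_mul_prod_filter_not _ (fun s => i ∈ inc s),
      filter_mem_eq_map he hinc, Finset.prod_map]
    congr 1
    · refine Finset.prod_congr rfl fun s _ => congrArg _ (hσ₁ _ ?_)
      rw [hinc]
      exact Finset.mem_insert_self _ _
    · rw [Finset.prod_congr rfl fun s hs => hσ₂ s (Finset.mem_filter.1 hs).2, hY,
        ← Finset.prod_subtype (Finset.univ.erase i) (by simp)
          (fun k => ∏ s with k ∈ inc s ∧ i ∉ inc s, μ (s, k))]
      refine Finset.prod_comm' fun s k => ?_
      simp only [Finset.mem_filter, Finset.mem_univ, true_and, Finset.mem_erase, and_true]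
      exact ⟨fun h => ⟨⟨h.2, h.1⟩, fun hk => h.1 (hk ▸ h.2)⟩, fun h => ⟨h.1.2, h.1.1⟩⟩
  have heffects : ∏ k, effect (a k) =
      (∏ s, disc (e s, i)) * ∏ k : {k // k ≠ i}, effect (a k.1) := by
    rw [← Finset.mul_prod_erase _ _ (Finset.mem_univ i), hd.eq_prod hT ha,
      filter_mem_eq_map he hinc, Finset.prod_map]
    rw [Finset.prod_subtype (Finset.univ.erase i) (p := fun k => k ≠ i) (by simp)
      fun k => effect (a k)]
  -- `h₁` collects the discards of the wires to `i`, and `h₂` the absorptions of `Y` into the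
  -- remaining effects. Undoing `h₂` (in `h₃`) and then `h₁` (in `h₄`) recovers the broken network.
  have h₁ := Comp.prod Finset.univ fun s _ => hτ' s
  rw [Finset.prod_mul_distrib, ← ident_sum] at h₁
  have h₂ := Comp.prod Finset.univ fun k _ => Comp.mk_effect (h k) (a k.1)
  simp only [hh', Finset.prod_mul_distrib] at h₂
  rw [← hY, ← ident_sum] at h₂
  have hn := nodup_cod_states inc A σ'
  rw [hstates] at hn
  have hcod : (∏ s, disc (e s, i)).cod = 0 := (hd.prod_det _ _).2.2
  have h₃ : Comp ((∏ s, state (τ s)) * Y) (∏ k : {k // k ≠ i}, effect (a k.1)) (scalar A s₀) := by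
    rw [mul_comm]
    refine Comp.slide_state hYdom ?_ ?_ h₂ hc
    -- Each `τ s` has only some of the wires of `σ (e s)`, so no name becomes repeated.
    · refine Multiset.nodup_of_le ?_ hn
      rw [cod_mul, cod_mul, add_comm, h₁.cod_eq, h₁.mid_eq, cod_mul, hcod, zero_add, dom_mul,
        cod_ident, dom_ident]
      exact add_le_add_left (Multiset.le_add_left _ _) _
    · rw [hc.mid_eq, h₂.dom_eq, dom_mul, hYdom, zero_add, dom_ident]
  have h₄ := h₁.slide_effect hcod hn h₃
  have hc' := comp_closedEvent inc A σ' a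
  rw [hstates, heffects] at hc'
  exact scalar_injective (h₄.unique hn hc')

end OperationalTheory

/-! ### Marginal probabilities and the conclusion. -/

namespace OperationalTheory

variable {C : Type u} [Category.{v} C] [MonoidalCategory C] [SymmetricCategory C]
  {T : OperationalTheory C} {S P : Type} [Fintype S] [Fintype P] [DecidableEq P]
  {inc : S → Finset P} {A : S × P → C} {V : P → Type} [∀ j, Fintype (V j)]

/-- Marginal probabilities: the measurements whose outcomes are ignored are replaced by discarding
tests. -/
theorem IsCausal.sum_mem_prob_closedEvent [∀ j, Nonempty (V j)] (hT : T.IsCausal)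
    (σ : ∀ s, 𝟙_ C ⟶ tens A (outWires inc s)) {M : ∀ j, V j → (tens A (inWires inc j) ⟶ 𝟙_ C)}
    (hM : ∀ j, T.IsTest (M j)) {d : ∀ j, tens A (inWires inc j) ⟶ 𝟙_ C} (hd : ∀ j, T.IsDet (d j))
    (K : Finset P) (u : ∀ j, V j) {s : Finset (∀ j, V j)}
    (hs : ∀ v, v ∈ s ↔ ∀ j ∉ K, v j = u j) :
    ∑ v ∈ s, T.prob (closedEvent inc A σ (fun j => M j (v j))) =
      T.prob (closedEvent inc A σ (fun j => if j ∈ K then d j else M j (u j))) := by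
  classical
  have e : s = Finset.univ.filter fun v => ∀ j ∉ K, v j = u j := by
    ext v
    simp [hs]
  rw [e]
  exact sum_filter_eq_of_sum_update M d (fun a => T.prob (closedEvent inc A σ a))
    (fun k a => hT.sum_prob_closedEvent inc A σ a k (hM k) (hd k)) K u

/-- A closed event built from tests with a single outcome has probability one. -/
theorem prob_closedEvent_det {σ : ∀ s, 𝟙_ C ⟶ tens A (outWires inc s)} (hσ : ∀ s, T.IsDet (σ s))
    {d : ∀ j, tens A (inWires inc j) ⟶ 𝟙_ C} (hd : ∀ j, T.IsDet (d j)) :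
    T.prob (closedEvent inc A σ d) = 1 := by
  have h : T.NetDet (Net.scalar A (closedEvent inc A σ d)) :=
    .comp (Net.comp_closedEvent inc A σ d) (.prod _ fun s _ => netDet_state.2 (hσ s))
      (.prod _ fun j _ => netDet_effect.2 (hd j))
  simpa using T.sum_prob (netDet_mk (l := []) (l' := []).1 h)

end OperationalTheory

/-- Adding the party `i` to the sets of `m - 1` other parties. -/
def insertParty {n m : ℕ} (hm : 1 ≤ m) (i : Fin n) :
    {J : Finset {k : Fin n // k ≠ i} // J.card = m - 1} ↪ {I : Finset (Fin n) // I.card = m} where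
  toFun J := ⟨insert i (J.1.map (Function.Embedding.subtype _)), by
    rw [Finset.card_insert_of_notMem (by simp), Finset.card_map, J.2]
    omega⟩
  inj' J J' h := by
    have h' := congrArg (fun I => I.1.erase i) h
    simp only at h'
    rw [Finset.erase_insert (by simp), Finset.erase_insert (by simp)] at h'
    exact Subtype.ext (Finset.map_injective _ h')

theorem mem_range_insertParty {n m : ℕ} (hm : 1 ≤ m) {i : Fin n}
    {I : {I : Finset (Fin n) // I.card = m}} (h : i ∈ I.1) :
    I ∈ Set.range (insertParty hm i) := by
  have e : ((I.1.erase i).subtype fun k => k ≠ i).map (Function.Embedding.subtype _) =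
      I.1.erase i := by
    ext k
    simp [and_comm]
  refine ⟨⟨(I.1.erase i).subtype fun k => k ≠ i, ?_⟩, Subtype.ext ?_⟩
  · rw [← Finset.card_map (Function.Embedding.subtype _), e, Finset.card_erase_of_mem h, I.2]
  · change insert i (((I.1.erase i).subtype fun k => k ≠ i).map _) = I.1
    rw [e, Finset.insert_erase h]

theorem mainTheorem8 {C : Type u} [Category.{v} C] [MonoidalCategory C] [SymmetricCategory C]
    (T : OperationalTheory C) (hT : T.IsCausal)
    (n m : ℕ) (hm : 1 ≤ m) (hmn : m ≤ n)
    (V : Fin n → Type) [∀ j, Fintype (V j)]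
    (p : stdSimplex ℝ (∀ j, V j)) (hp : ArisesFromGBN T m p) (i : Fin n) :
    ∃ p' : stdSimplex ℝ (∀ j, V j),
      (∀ j, j ≠ i →
        stdSimplex.map (fun v : (∀ k, V k) => (v i, v j)) p' =
          stdSimplex.map (fun v : (∀ k, V k) => (v i, v j)) p) ∧
      ArisesFromGBN T (m - 1)
        (stdSimplex.map (fun (v : ∀ k, V k) (k : {k : Fin n // k ≠ i}) => v k) p') := by
  classical
  -- There is no distribution on an empty set, so every variable has a value.
  have hV : Nonempty (∀ j, V j) := by
    by_contra h
    rw [not_nonempty_iff] at h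
    simpa using stdSimplex.sum_eq_one p
  have hV' : ∀ j, Nonempty (V j) := fun j => hV.map fun v => v j
  obtain ⟨u₀⟩ := hV
  obtain ⟨A, σ, M, hσ, hM, hp⟩ := hp
  choose d hd _ using fun j => hT (tens A (inWires Subtype.val j))
  choose disc hdisc using fun w => hT.exists_discard (A := A) {w}
  have hdisc : T.IsDiscard disc := hdisc
  obtain ⟨μ, hμ⟩ := hdisc.exists_marginal σ
  obtain ⟨σ', hσ', hσ₁, hσ₂⟩ := hμ.exists_broken hdisc hσ i
  obtain ⟨σ'', g, hσ'', hg, hred⟩ := hμ.exists_reduced (e := insertParty hm i)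
    (inc' := Subtype.val) hT hdisc hσ hσ₁ hσ₂ (fun I hI => mem_range_insertParty hm hI)
    (fun _ => rfl)
  -- `p'` uses the broken states with the original measurements. In the reduced network the
  -- measurement of `k` first adjoins its absorbed marginals through `g k`.
  refine ⟨⟨fun v => T.prob (closedEvent Subtype.val A σ' fun j => M j (v j)),
    fun _ => T.prob_nonneg _, ?_⟩, fun j hj => ?_, fun w => A (OperationalTheory.wireMap (insertParty hm i) i w), σ'',
    fun k x => g k ≫ M k.1 x, hσ'', fun k => (hg k).comp_isTest (hM k.1), fun v => ?_⟩
  -- Total mass: every measurement is discarded, so `u₀` plays no role.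
  · have h := hT.sum_mem_prob_closedEvent σ' hM hd Finset.univ u₀ (s := Finset.univ) (by simp)
    simpa [OperationalTheory.prob_closedEvent_det hσ' hd] using h
  · ext ⟨x, y⟩
    obtain ⟨u, rfl, rfl⟩ : ∃ u : ∀ k, V k, u i = x ∧ u j = y :=
      ⟨Function.update (Function.update u₀ i x) j y, by
        rw [Function.update_of_ne hj.symm, Function.update_self], Function.update_self _ _ _⟩
    have hs : ∀ v : ∀ k, V k, v ∈ Finset.univ.filter (fun v => (v i, v j) = (u i, u j)) ↔
        ∀ k ∉ Finset.univ \ {i, j}, v k = u k := by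
      intro v
      simp only [Finset.mem_filter, Finset.mem_univ, true_and, Prod.mk.injEq, Finset.mem_sdiff,
        Finset.mem_insert, Finset.mem_singleton, not_not]
      exact ⟨fun h k => by rintro (rfl | rfl); exacts [h.1, h.2],
        fun h => ⟨h i (.inl rfl), h j (.inr rfl)⟩⟩
    rw [stdSimplex.map_coe, stdSimplex.map_coe, FunOnFinite.linearMap_apply_apply,
      FunOnFinite.linearMap_apply_apply, Finset.sum_congr rfl fun v _ => hp v]
    refine (hT.sum_mem_prob_closedEvent σ' hM hd _ u hs).trans
      (Eq.trans ?_ (hT.sum_mem_prob_closedEvent σ hM hd _ u hs).symm)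
    -- Both marginals now discard every party except `i` and `j`, where broken sources go unnoticed.
    refine congrArg _ (hμ.closedEvent_broken hT hdisc hσ hj hσ₁ hσ₂ _ fun k hki hkj => ?_).symm
    rw [if_pos (by simp [hki, hkj])]
    exact hd k
  -- The value of `u` at `i` is arbitrary, because the outcome of `i` is summed over.
  · obtain ⟨u, rfl⟩ : ∃ u : ∀ k, V k, (fun k : {k // k ≠ i} => u k.1) = v :=
      ⟨fun k => if h : k ≠ i then v ⟨k, h⟩ else u₀ k, by
        ext k
        simp [k.2]⟩
    rw [stdSimplex.map_coe, FunOnFinite.linearMap_apply_apply]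
    refine (hT.sum_mem_prob_closedEvent σ' hM hd {i} u ?_).trans ?_
    · intro v
      simp [funext_iff]
    · rw [← hred]
      · refine congrArg (fun a => T.prob (closedEvent _ _ σ'' a)) (funext fun k => ?_)
        rw [if_neg (by simpa using k.2)]
      · rw [if_pos (Finset.mem_singleton_self i)]
        exact hd i
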